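/- **Setting.** Let $p_c, q_c$ be probability densities on $\mathbb R^d$ with $p_c>0$ everywhere (for instance the piecewise continuous densities $p_c\propto p_0\,p_*(\Gamma)$, $q_c\propto p_0\,q_*(\Gamma)$ that represent two discrete distributions $p_*,q_*$ through a partition $\Gamma$ of a base density $p_0$), and let $\rho>0$ be a $C^1$ surrogate density (its normalization is irrelevant) with score $s_\rho=\nabla\log\rho$. Put $w=\rho/p_c$. Let $k$ be a symmetric positive definite kernel on $\mathbb R^d$ of class $C^2$ and $$\kappa_\rho(x,x')=s_\rho(x)^\top k(x,x')s_\rho(x')+s_\rho(x)^\top\nabla_{x'}k(x,x')+s_\rho(x')^\top\nabla_xk(x,x')+\nabla_x\!\cdot\!\nabla_{x'}k(x,x').$$ The squared gradient-free kernelized Stein discrepancy is $\widetilde{\mathbb S}(q_c,p_c)=\mathbb E_{x,x'\sim q_c}[w(x)\kappa_\rho(x,x')w(x')]$, with $x,x'$ independent. For a sample $x_1,\dots,x_n$ let $$\hat{\mathbb S}=\frac1{n(n-1)}\sum_{i\ne j}w(x_i)\kappa_\rho(x_i,x_j)w(x_j),\qquad \hat{\mathbb S}^*=\sum_{i\neq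 j}\Big(u_i-\frac1n\Big)w(x_i)\kappa_\rho(x_i,x_j)w(x_j)\Big(u_j-\frac1n\Big),$$ where $(nu_1,\dots,nu_n)\sim\mathrm{Multi}(n;1/n,\dots,1/n)$. Given $m$ independent bootstrap copies $\hat{\mathbb S}^*_1,\dots,\hat{\mathbb S}^*_m$ (weights independent of the sample), let $\gamma_{1-\alpha}=\inf\{t: \frac1m\#\{b:\hat{\mathbb S}^*_b\le t\}\ge 1-\alpha\}$. **Assumptions.** There are a locally finite Borel measure $\mu$ on $\mathbb R^d$ and a locally $\mu$-integrable vector field $G$ such that $q_c/p_c$ is locally Lebesgue integrable with distributional gradient $\nabla(q_c/p_c)=G\,d\mu$. (If $p_c,q_c$ are positive and $C^1$, one takes $\mu$ to be Lebesgue measure, and then $\rho\,G=q_c\,w\,(s_{q_c}-s_{p_c})$; if they are piecewise $C^1$, $\mu$ is Lebesgue measure plus surface measure on the discontinuity set, where $G$ is the jump of $q_c/p_c$ times the unit normal.) Moreover: 1. $k$ is integrally strictly positive definite with respect to $\mu$: $\iint g(x)k(x,x')g(x')\,d\mu\,d\mu>0$ for every $g$ with $0<\|g\|_{L^2(\mu)}<\infty$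 for which the double integral converges absolutely; 2. $\|\rho\,G\|_{L^2(\mu)}^2<\infty$; 3. $\widetilde{\mathbb S}(q_c,p_c)<\infty$, in the sense that both $\mathbb E_{x,x'\sim q_c}|w(x)\kappa_\rho(x,x')w(x')|$ and $\iint |k(x,x')|\,\|\rho G(x)\|\,\|\rho G(x')\|\,d\mu\,d\mu$ are finite; 4. $\mathbb E_{x\sim q_c}\big[w(x)\sqrt{k(x,x)}\big]<\infty$ (no boundary terms at infinity in Stein's identity). **Claim.** Let $0<\alpha<1$ and let $m=m_n\ge1$ be any numbers of bootstrap replicates (for instance constant). If $q_c$ and $p_c$ are not equal almost everywhere and $x_1,\dots,x_n$ are i.i.d. from $q_c$, then $$\lim_{n\to\infty}\Pr\big(\hat{\mathbb S}\ge\gamma_{1-\alpha}\big)=\lim_{n\to\infty}\Pr\big(\hat{\mathbb S}>\gamma_{1-\alpha}\big)=1,$$ i.e. the bootstrap goodness-of-fit test, which rejects $H_0:q_c=p_c$ when $\hat{\mathbb S}$ reaches (or exceeds) $\gamma_{1-\alpha}$, is consistent in power against every fixed alternative $q_c\ne p_c$. -/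

import Mathlib

open MeasureTheory ProbabilityTheory Filter Topology

noncomputable section

/-- The Euclidean space `ℝ^d`. -/
abbrev Rd (d : ℕ) : Type := EuclideanSpace ℝ (Fin d)

/-! ### Densities and distributional gradients -/

/-- `f` is a probability density with respect to Lebesgue measure. -/
structure IsProbDensity {d : ℕ} (f : Rd d → ℝ) : Prop where
  measurable : Measurable f
  nonneg : ∀ x, 0 ≤ f x
  lintegral_eq_one : ∫⁻ x, ENNReal.ofReal (f x) = 1

/-- The probability measure with density `f`. -/
def densityMeasure {d : ℕ} (f : Rd d → ℝ) : Measure (Rd d) :=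
  volume.withDensity fun x => ENNReal.ofReal (f x)

/-- The distributional gradient of the locally integrable function `r` is the vector measure
`G dμ`. For `r` of class `C^1` this holds with `μ` Lebesgue measure and `G = ∇ r`; for a piecewise
`C^1` function, `μ` is Lebesgue measure plus the surface measure of the discontinuity set, and
on that set `G` is the jump of `r` times the unit normal. -/
structure HasDistribGradient {d : ℕ} (r : Rd d → ℝ) (μ : Measure (Rd d)) (G : Rd d → Rd d) :
    Prop where
  locallyIntegrable : LocallyIntegrable r volume
  locallyIntegrable_grad : LocallyIntegrable G μ
  integral_eq : ∀ φ : Rd d → ℝ, ContDiff ℝ 1 φ → HasCompactSupport φ → ∀ v : Rd d,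
    ∫ x, r x * fderiv ℝ φ x v = -∫ x, φ x * inner ℝ (G x) v ∂μ

/-! ### Kernels -/

/-- Symmetric positive (semi)definite kernel, the kernel of an RKHS. -/
structure IsPDKernel {d : ℕ} (k : Rd d → Rd d → ℝ) : Prop where
  symm : ∀ x y, k x y = k y x
  nonneg : ∀ (n : ℕ) (x : Fin n → Rd d) (c : Fin n → ℝ),
    0 ≤ ∑ i, ∑ j, c i * c j * k (x i) (x j)

/-- `k` is integrally strictly positive definite with respect to `μ`: the energy
`∬ g(x) k(x,y) g(y) dμ(x) dμ(y)` is positive for every `g` with `0 < ‖g‖_{L²(μ)} < ∞` for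
which this double integral converges absolutely. -/
def IsIntegrallyStrictlyPD {d : ℕ} (k : Rd d → Rd d → ℝ) (μ : Measure (Rd d)) : Prop :=
  ∀ g : Rd d → ℝ, MemLp g 2 μ → ¬ (g =ᵐ[μ] 0) →
    Integrable (fun z : Rd d × Rd d => g z.1 * k z.1 z.2 * g z.2) (μ.prod μ) →
    0 < ∫ z, g z.1 * k z.1 z.2 * g z.2 ∂(μ.prod μ)

/-! ### The gradient-free kernelized Stein discrepancy -/

/-- The score function `s_ρ = ∇ log ρ`. -/
def score {d : ℕ} (ρ : Rd d → ℝ) (x : Rd d) : Rd d :=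
  gradient (fun z => Real.log (ρ z)) x

/-- `∇_x k(x,y)`. -/
def gradFst {d : ℕ} (k : Rd d → Rd d → ℝ) (x y : Rd d) : Rd d :=
  gradient (fun z => k z y) x

/-- `∇_y k(x,y)`. -/
def gradSnd {d : ℕ} (k : Rd d → Rd d → ℝ) (x y : Rd d) : Rd d :=
  gradient (fun z => k x z) y

/-- `∇_x · (∇_y k(x,y)) = ∑ᵢ ∂_{xᵢ} ∂_{yᵢ} k(x,y)`. -/
def divGrad {d : ℕ} (k : Rd d → Rd d → ℝ) (x y : Rd d) : ℝ :=
  ∑ i : Fin d, fderiv ℝ (fun z => gradSnd k z y i) x (EuclideanSpace.single i 1)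

/-- The Stein kernel `κ_ρ(x,y)` of the surrogate `ρ`. -/
def steinKernel {d : ℕ} (k : Rd d → Rd d → ℝ) (ρ : Rd d → ℝ) (x y : Rd d) : ℝ :=
  inner ℝ (score ρ x) (k x y • score ρ y) + inner ℝ (score ρ x) (gradSnd k x y)
    + inner ℝ (score ρ y) (gradFst k x y) + divGrad k x y

/-- The importance weight `w = ρ / p`. -/
def weight {d : ℕ} (ρ p : Rd d → ℝ) (x : Rd d) : ℝ := ρ x / p x

/-- The weighted kernel `w(x) κ_ρ(x,y) w(y)`; its expectation under `x, y ∼ q` independent is the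
squared gradient-free kernelized Stein discrepancy between `q` and `p`. -/
def gfKernel {d : ℕ} (k : Rd d → Rd d → ℝ) (ρ p : Rd d → ℝ) (x y : Rd d) : ℝ :=
  weight ρ p x * steinKernel k ρ x y * weight ρ p y

/-! ### The test -/

/-- The U-statistic `(1 / (n (n-1))) ∑_{i ≠ j} h(xᵢ, xⱼ)`. -/
def uStat {d : ℕ} (h : Rd d → Rd d → ℝ) {n : ℕ} (x : Fin n → Rd d) : ℝ :=
  1 / (((n : ℝ) - 1) * n) * ∑ i, ∑ j, if i ≠ j then h (x i) (x j) else 0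

/-- The bootstrap statistic `∑_{i ≠ j} (uᵢ - 1/n) h(xᵢ, xⱼ) (uⱼ - 1/n)`, where `uᵢ = Nᵢ / n` are the
normalized multinomial weights obtained from the counts `Nᵢ`. -/
def bootStat {d : ℕ} (h : Rd d → Rd d → ℝ) {n : ℕ} (x : Fin n → Rd d) (N : Fin n → ℕ) : ℝ :=
  ∑ i, ∑ j, if i ≠ j then
    ((N i : ℝ) / n - 1 / n) * h (x i) (x j) * ((N j : ℝ) / n - 1 / n) else 0

/-- The distribution `Multi(n; 1/n, …, 1/n)`: the law of the vector of counts of `n` independent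
uniform draws from `{1, …, n}`. -/
def multinomialUniform (n : ℕ) : Measure (Fin n → ℕ) :=
  (Measure.pi fun _ : Fin n => (uniformOn Set.univ : Measure (Fin n))).map
    fun I i => (Finset.univ.filter fun l => I l = i).card

/-- The `β`-quantile of the empirical distribution of `s₁, …, s_m`. -/
def empQuantile {m : ℕ} (β : ℝ) (s : Fin m → ℝ) : ℝ :=
  sInf {t : ℝ | β ≤ ((Finset.univ.filter fun b => s b ≤ t).card : ℝ) / m}

/-- The critical value `γ_{1-α}`: the `(1-α)`-quantile of the `m` bootstrap statistics. -/
def critValue {d : ℕ} (h : Rd d → Rd d → ℝ) (α : ℝ) {n m : ℕ} (x : Fin n → Rd d)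
    (N : Fin m → Fin n → ℕ) : ℝ :=
  empQuantile (1 - α) fun b => bootStat h x (N b)

/-- Joint law of an i.i.d. sample of size `n` with density `q` and of `m` independent multinomial
vectors, independent of the sample. -/
def testLaw {d : ℕ} (q : Rd d → ℝ) (n m : ℕ) :
    Measure ((Fin n → Rd d) × (Fin m → Fin n → ℕ)) :=
  (Measure.pi fun _ : Fin n => densityMeasure q).prod
    (Measure.pi fun _ : Fin m => multinomialUniform n)

end

/-! The argument has two independent halves: the discrepancy `S` is strictly positive under the
alternative, and the test detects any integrable kernel with positive mean.

Positivity. Put `r = q / p`. Since `ρ(x) ρ(y) κ_ρ(x, y) = ∑ᵢ ∂_{xᵢ} ∂_{yᵢ} (ρ(x) ρ(y) k(x, y))`,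
moving both derivatives onto `r` turns `S` into the energy `∑ᵢ ∬ ρGᵢ k ρGᵢ dμ dμ`
(`integral_gfKernel_eq`). The integration by parts is done with a cutoff `χ` and a feature map `Φ`
of `k`: the localized discrepancy is exactly `∑ᵢ ‖∫ χ ρ Gᵢ Φ dμ + ∫ r ρ ∂ᵢχ Φ dx‖²`
(`integral_steinWitness_eq_norm_sq`). As `χ` exhausts the space the second integral vanishes,
because `‖∇χ‖` tends to zero uniformly and `r ρ ‖Φ‖ = q w √k(x,x)` is integrable. Strict positive
definiteness then gives `S > 0` unless `G = 0` almost everywhere for `μ`; in that case `r` has zero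
weak gradient, hence is constant, and normalization forces `q = p` (`integral_gfKernel_pos`).

The test. The weighted kernel is only known to be integrable, so second-moment arguments do not
apply to it directly. The centered U-statistic and the bootstrap statistic are, however, linear in
the kernel and bounded in `L¹` uniformly in `n`. By density it suffices to treat indicators of
rectangles, where variance bounds for sums of i.i.d. variables are enough
(`tendsto_integral_abs_of_rect`). Thus the U-statistic tends to `S` and the bootstrap statistic to
`0`, both in `L¹`. By Markov's inequality, with probability tending to one the U-statistic exceeds
`S/2` while fewer than a fraction `α` of the replicates exceed `S/4`, so that the critical value is
at most `S/4`. Only the mean of the average of the absolute values of the replicates enters, and it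
does not depend on `m`, so `m` is arbitrary (`tendsto_testLaw_of_integral_pos`). -/

/-! ### Approximation in `L¹` of a product, and pairs of sample points. -/

/-- Induction principle for integrable functions on a product of finite measure spaces: it suffices
to treat indicators of measurable rectangles, linear combinations, and limits in `L¹`. -/
theorem integrable_prod_induction {X Y : Type*} [MeasurableSpace X] [MeasurableSpace Y]
    (μ : Measure X) (ν : Measure Y) [IsFiniteMeasure μ] [IsFiniteMeasure ν]
    (P : (X × Y → ℝ) → Prop)
    (rect : ∀ A B, MeasurableSet A → MeasurableSet B → P ((A ×ˢ B).indicator fun _ => 1))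
    (add : ∀ f g, Integrable f (μ.prod ν) → Integrable g (μ.prod ν) → P f → P g →
      P fun z => f z + g z)
    (smul : ∀ (c : ℝ) f, Integrable f (μ.prod ν) → P f → P fun z => c * f z)
    (closed : ∀ f, Integrable f (μ.prod ν) → (∀ ε > 0, ∃ g, Integrable g (μ.prod ν) ∧ P g ∧
      ∫ z, |f z - g z| ∂(μ.prod ν) ≤ ε) → P f)
    (f : X × Y → ℝ) (hf : Integrable f (μ.prod ν)) : P f := by
  have hind : ∀ s : Set (X × Y), MeasurableSet s →
      Integrable (s.indicator fun _ => (1 : ℝ)) (μ.prod ν) := fun s hs =>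
    (integrable_const 1).indicator hs
  -- Dynkin's π-λ argument: rectangles form a generating π-system; for countable disjoint unions the
  -- partial unions converge in `L¹` by dominated convergence.
  have key : ∀ s : Set (X × Y), MeasurableSet s → P (s.indicator fun _ => 1) := by
    intro s hs
    induction s, hs using MeasurableSpace.induction_on_inter generateFrom_prod.symm isPiSystem_prod
    with
    | empty => simpa using rect ∅ ∅ .empty .empty
    | basic t ht =>
      obtain ⟨A, hA, B, hB, rfl⟩ := ht
      exact rect A B hA hB
    | compl t ht ih =>
      have h1 := add _ _ (hind _ (MeasurableSet.univ.prod MeasurableSet.univ))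
        ((hind t ht).const_mul (-1)) (rect _ _ .univ .univ) (smul (-1) _ (hind t ht) ih)
      convert h1 using 2 with z
      by_cases hz : z ∈ t <;> simp [hz]
    | iUnion g hd hg ih =>
      have hfin : ∀ n, P ((⋃ i < n, g i).indicator fun _ => 1) := by
        intro n
        induction n with
        | zero => simpa using rect ∅ ∅ .empty .empty
        | succ n ihn =>
          have hm : MeasurableSet (⋃ i < n, g i) := .biUnion (Set.to_countable _) fun i _ => hg i
          have h1 := add _ _ (hind _ hm) (hind _ (hg n)) ihn (ih n)
          convert h1 using 2 with z
          have hdis : Disjoint (⋃ i < n, g i) (g n) := by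
            simp only [Set.disjoint_iUnion_left]
            intro i hi
            exact hd hi.ne
          have hU : (⋃ i < n + 1, g i) = (⋃ i < n, g i) ∪ g n := by
            ext z
            simp only [Set.mem_iUnion, Set.mem_union, Nat.lt_succ_iff_lt_or_eq, exists_prop]
            constructor
            · rintro ⟨i, hi | rfl, hz⟩
              · exact Or.inl ⟨i, hi, hz⟩
              · exact Or.inr hz
            · rintro (⟨i, hi, hz⟩ | hz)
              · exact ⟨i, Or.inl hi, hz⟩
              · exact ⟨n, Or.inr rfl, hz⟩
          rw [hU, Set.indicator_union_of_disjoint hdis]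
      refine closed _ (hind _ (.iUnion hg)) fun ε hε => ?_
      have hlim : Tendsto (fun n => ∫ z, |(⋃ i, g i).indicator (fun _ => (1 : ℝ)) z
          - (⋃ i < n, g i).indicator (fun _ => 1) z| ∂(μ.prod ν)) atTop (𝓝 (∫ _, 0 ∂(μ.prod ν))) := by
        refine tendsto_integral_of_dominated_convergence (fun _ => 2) (fun n => ?_)
          (integrable_const _) (fun n => ?_) ?_
        · exact ((hind _ (.iUnion hg)).sub (hind _ (.biUnion (Set.to_countable _)
            fun i _ => hg i))).abs.aestronglyMeasurable
        · filter_upwards with z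
          simp only [Set.indicator]
          split_ifs <;> norm_num
        · filter_upwards with z
          by_cases hz : z ∈ ⋃ i, g i
          · obtain ⟨N, hN⟩ := Set.mem_iUnion.1 hz
            refine tendsto_const_nhds.congr' ?_
            filter_upwards [eventually_gt_atTop N] with n hn
            have : z ∈ ⋃ i < n, g i := by
              simp only [Set.mem_iUnion]; exact ⟨N, hn, hN⟩
            simp [Set.indicator_of_mem hz, Set.indicator_of_mem this]
          · refine tendsto_const_nhds.congr fun n => ?_
            have : z ∉ ⋃ i < n, g i := by
              intro h
              simp only [Set.mem_iUnion] at h hz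
              obtain ⟨i, -, hi⟩ := h
              exact hz ⟨i, hi⟩
            rw [Set.indicator_of_notMem hz, Set.indicator_of_notMem this]
            simp
      simp only [integral_zero] at hlim
      obtain ⟨n, hn⟩ := (hlim.eventually (gt_mem_nhds hε)).exists
      exact ⟨_, hind _ (.biUnion (Set.to_countable _) fun i _ => hg i), hfin n, hn.le⟩
  have hsimple : ∀ g : SimpleFunc (X × Y) ℝ, P g := by
    intro g
    induction g using SimpleFunc.induction with
    | const c hs =>
      have h1 := smul c _ (hind _ hs) (key _ hs)
      convert h1 using 2 with z
      simp [Set.indicator, Set.piecewise]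
    | add hd ihf ihg =>
      exact add _ _ (SimpleFunc.integrable_of_isFiniteMeasure _)
        (SimpleFunc.integrable_of_isFiniteMeasure _) ihf ihg
  refine closed f hf fun ε hε => ?_
  obtain ⟨g, hg, -⟩ := (memLp_one_iff_integrable.2 hf).exists_simpleFunc_eLpNorm_sub_lt
    ENNReal.one_ne_top (ENNReal.ofReal_pos.2 hε).ne'
  refine ⟨g, SimpleFunc.integrable_of_isFiniteMeasure _, hsimple g, ?_⟩
  have h1 : ∫ z, |f z - g z| ∂(μ.prod ν) = (eLpNorm (f - ⇑g) 1 (μ.prod ν)).toReal := by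
    rw [eLpNorm_one_eq_lintegral_enorm, ← integral_norm_eq_lintegral_enorm
      (hf.sub (SimpleFunc.integrable_of_isFiniteMeasure g)).aestronglyMeasurable]
    rfl
  rw [h1]
  exact ENNReal.toReal_le_of_le_ofReal hε.le hg.le

/-- Reduces the mean of each off-diagonal term of the statistics to an integral over `Q.prod Q`. -/
theorem measurePreserving_eval_pair {X : Type*} [MeasurableSpace X] (Q : Measure X)
    [IsProbabilityMeasure Q] {ι : Type*} [Fintype ι] {i j : ι} (hij : i ≠ j) :
    MeasurePreserving (fun x : ι → X => (x i, x j)) (Measure.pi fun _ => Q) (Q.prod Q) := by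
  have hind : iIndepFun (fun (i : ι) (x : ι → X) => x i) (Measure.pi fun _ => Q) :=
    iIndepFun_pi (X := fun _ => id) fun _ => aemeasurable_id
  refine ⟨by fun_prop, ?_⟩
  have := (indepFun_iff_map_prod_eq_prod_map_map
    (measurable_pi_apply i).aemeasurable (measurable_pi_apply j).aemeasurable).1
    (hind.indepFun hij)
  rw [this, (measurePreserving_eval (fun _ : ι => Q) i).map_eq,
    (measurePreserving_eval (fun _ : ι => Q) j).map_eq]

/-! ### Moments of the multinomial weights. -/

section Multinomial

instance isProbabilityMeasure_multinomialUniform (n : ℕ) :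
    IsProbabilityMeasure (multinomialUniform n) := by
  have : ∀ _ : Fin n, IsProbabilityMeasure (uniformOn Set.univ : Measure (Fin n)) := fun i =>
    have : Nonempty (Fin n) := ⟨i⟩
    isProbabilityMeasure_uniformOn Set.finite_univ Set.univ_nonempty
  exact Measure.isProbabilityMeasure_map (Measurable.of_discrete).aemeasurable

/-- The law is the image of a measure on the finite set of all sequences of draws. -/
theorem integrable_multinomialUniform {n : ℕ} (g : (Fin n → ℕ) → ℝ) :
    Integrable g (multinomialUniform n) := by
  rw [multinomialUniform, integrable_map_measure Measurable.of_discrete.aestronglyMeasurable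
    Measurable.of_discrete.aemeasurable]
  have : IsFiniteMeasure (uniformOn Set.univ : Measure (Fin n)) := by infer_instance
  exact Integrable.of_finite

theorem integral_multinomialUniform {n : ℕ} (g : (Fin n → ℕ) → ℝ) :
    ∫ N, g N ∂multinomialUniform n = ∫ I : Fin n → Fin n,
      g (fun i => (Finset.univ.filter fun l => I l = i).card)
        ∂(Measure.pi fun _ : Fin n => (uniformOn Set.univ : Measure (Fin n))) :=
  integral_map Measurable.of_discrete.aemeasurable Measurable.of_discrete.aestronglyMeasurable

theorem integral_uniformOn_univ {n : ℕ} (a : Fin n → ℝ) :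
    ∫ i, a i ∂(uniformOn Set.univ : Measure (Fin n)) = (∑ i, a i) / n := by
  rw [integral_fintype Integrable.of_finite]
  simp [Measure.real, uniformOn_univ, Finset.mul_sum, div_eq_inv_mul, ENNReal.toReal_inv]

/-- Passing from counts to draws exhibits a linear form in dependent multinomial counts as a sum of
independent terms. -/
theorem sum_card_filter_mul {n : ℕ} (I : Fin n → Fin n) (a : Fin n → ℝ) :
    ∑ i, ((Finset.univ.filter fun l => I l = i).card : ℝ) * a i = ∑ l, a (I l) := by
  simp only [Finset.card_eq_sum_ones, Nat.cast_sum, Finset.sum_mul, Finset.sum_filter]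
  push_cast
  simp only [ite_mul, one_mul, zero_mul]
  rw [Finset.sum_comm]
  simp

/-- In terms of the draws `I l`, the linear form is `(∑ l, a (I l) - ∑ i, a i) / n`, a centered sum
of `n` i.i.d. terms, each of variance at most `(∑ i, a i ^ 2) / n`. -/
theorem integral_sq_multinomialUniform_le {n : ℕ} (a : Fin n → ℝ) :
    ∫ N, (∑ i, ((N i : ℝ) / n - 1 / n) * a i) ^ 2 ∂multinomialUniform n
      ≤ (∑ i, a i ^ 2) / n ^ 2 := by
  rcases Nat.eq_zero_or_pos n with rfl | hn
  · simp
  have : Nonempty (Fin n) := ⟨⟨0, hn⟩⟩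
  set U := (uniformOn Set.univ : Measure (Fin n)) with hU
  have : IsProbabilityMeasure U :=
    isProbabilityMeasure_uniformOn Set.finite_univ Set.univ_nonempty
  have hn' : (n : ℝ) ≠ 0 := by positivity
  rw [integral_multinomialUniform]
  have hfin : ∀ b : Fin n → ℝ, MemLp b 2 U := fun b => MemLp.of_discrete
  have hvar := variance_sum_pi (μ := fun _ : Fin n => U) (X := fun _ => a) fun _ => hfin a
  have hmean : (Measure.pi fun _ : Fin n => U)[∑ l : Fin n, fun I : Fin n → Fin n => a (I l)]
      = ∑ i, a i := by
    simp only [Finset.sum_apply]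
    rw [integral_finsetSum _ fun _ _ => Integrable.of_finite]
    have : ∀ l : Fin n, ∫ I : Fin n → Fin n, a (I l) ∂(Measure.pi fun _ : Fin n => U)
        = (∑ i, a i) / n := fun l => by
      have h1 := integral_map (μ := Measure.pi fun _ : Fin n => U) (φ := Function.eval l) (f := a)
        Measurable.of_discrete.aemeasurable Measurable.of_discrete.aestronglyMeasurable
      rw [(measurePreserving_eval (fun _ : Fin n => U) l).map_eq, integral_uniformOn_univ] at h1
      exact h1.symm
    simp only [this, Finset.sum_const, Finset.card_univ, Fintype.card_fin, nsmul_eq_mul]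
    field_simp
  have hpt : ∀ I : Fin n → Fin n,
      (∑ i, (((Finset.univ.filter fun l => I l = i).card : ℝ) / n - 1 / n) * a i) ^ 2
        = ((∑ l, a (I l)) - ∑ i, a i) ^ 2 / n ^ 2 := by
    intro I
    rw [← sum_card_filter_mul, ← div_pow, ← Finset.sum_sub_distrib, Finset.sum_div]
    congr 1
    refine Finset.sum_congr rfl fun i _ => ?_
    ring
  simp only [hpt]
  rw [integral_div]
  rw [variance_eq_integral Measurable.of_discrete.aemeasurable, hmean] at hvar
  simp only [Finset.sum_apply] at hvar
  rw [hvar]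
  refine div_le_div_of_nonneg_right ?_ (by positivity)
  calc ∑ _l : Fin n, Var[a; U] ≤ ∑ _l : Fin n, (∑ i, a i ^ 2) / n := by
        refine Finset.sum_le_sum fun l _ => ?_
        refine (variance_le_expectation_sq Measurable.of_discrete.aestronglyMeasurable).trans_eq ?_
        exact integral_uniformOn_univ fun i => a i ^ 2
    _ = ∑ i, a i ^ 2 := by
        simp only [Finset.sum_const, Finset.card_univ, Fintype.card_fin, nsmul_eq_mul]
        field_simp

theorem ae_sum_multinomialUniform (n : ℕ) :
    ∀ᵐ N ∂multinomialUniform n, ∑ i, (N i : ℝ) = n := by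
  rw [multinomialUniform, ae_map_iff Measurable.of_discrete.aemeasurable .of_discrete]
  refine Eventually.of_forall fun I => ?_
  simpa using sum_card_filter_mul I fun _ => 1

/-- Both weight vectors are nonnegative with total mass at most one. The square of this bound is the
constant `4` in `integral_abs_bootStat_le`. -/
theorem ae_sum_abs_weight_le (n : ℕ) :
    ∀ᵐ N ∂multinomialUniform n, ∑ i, |(N i : ℝ) / n - 1 / n| ≤ 2 := by
  filter_upwards [ae_sum_multinomialUniform n] with N hN
  rcases Nat.eq_zero_or_pos n with rfl | hn
  · simp
  calc ∑ i, |(N i : ℝ) / n - 1 / n| ≤ ∑ i, ((N i : ℝ) / n + 1 / n) := by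
        refine Finset.sum_le_sum fun i _ => (abs_sub _ _).trans_eq ?_
        rw [abs_of_nonneg (by positivity), abs_of_nonneg (by positivity)]
    _ = 2 := by
        rw [Finset.sum_add_distrib, ← Finset.sum_div, hN]
        simp
        field_simp
        norm_num

end Multinomial

/-! ### Reduction of `L¹` convergence to rectangles. -/

/-- Linear operators `T n` that are uniformly bounded in `L¹` and converge to zero in `L¹` on
indicators of rectangles converge to zero in `L¹` on all integrable functions. -/
theorem tendsto_integral_abs_of_rect {X : Type*} [MeasurableSpace X] (Q : Measure X)
    [IsFiniteMeasure Q] {Ω : ℕ → Type*} [∀ n, MeasurableSpace (Ω n)] (R : ∀ n, Measure (Ω n))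
    (T : ∀ n, (X × X → ℝ) → Ω n → ℝ) (C : ℝ) (hC : 0 ≤ C)
    (hadd : ∀ n f g, Integrable f (Q.prod Q) → Integrable g (Q.prod Q) → ∀ ω,
      T n (fun z => f z + g z) ω = T n f ω + T n g ω)
    (hsmul : ∀ n (c : ℝ) f ω, T n (fun z => c * f z) ω = c * T n f ω)
    (hint : ∀ n f, Integrable f (Q.prod Q) → Integrable (T n f) (R n))
    (hbound : ∀ n f, Integrable f (Q.prod Q) →
      ∫ ω, |T n f ω| ∂(R n) ≤ C * ∫ z, |f z| ∂(Q.prod Q))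
    (hrect : ∀ A B, MeasurableSet A → MeasurableSet B →
      Tendsto (fun n => ∫ ω, |T n ((A ×ˢ B).indicator fun _ => 1) ω| ∂(R n)) atTop (𝓝 0))
    (f : X × X → ℝ) (hf : Integrable f (Q.prod Q)) :
    Tendsto (fun n => ∫ ω, |T n f ω| ∂(R n)) atTop (𝓝 0) := by
  have hle : ∀ f g, Integrable f (Q.prod Q) → Integrable g (Q.prod Q) → ∀ n,
      ∫ ω, |T n (fun z => f z + g z) ω| ∂(R n) ≤ ∫ ω, |T n f ω| ∂(R n) + ∫ ω, |T n g ω| ∂(R n) := by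
    intro f g hf hg n
    rw [← integral_add (hint n f hf).abs (hint n g hg).abs]
    refine integral_mono (hint n _ (hf.add hg)).abs ((hint n f hf).abs.add (hint n g hg).abs)
      fun ω => ?_
    simp only [hadd n f g hf hg]
    exact abs_add_le _ _
  refine integrable_prod_induction Q Q
    (fun f => Tendsto (fun n => ∫ ω, |T n f ω| ∂(R n)) atTop (𝓝 0)) hrect ?_ ?_ ?_ f hf
  · intro f g hf hg h1 h2
    refine squeeze_zero (fun n => integral_nonneg fun ω => abs_nonneg _) (hle f g hf hg) ?_
    simpa using h1.add h2
  · intro c f hf h1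
    simp only [hsmul, abs_mul, integral_const_mul]
    simpa using h1.const_mul |c|
  · intro f hf h
    refine Metric.tendsto_atTop.2 fun ε hε => ?_
    -- Dividing by `C + 1` rather than `C` covers `C = 0`.
    obtain ⟨g, hg, hg0, hfg⟩ := h (ε / (2 * (C + 1))) (by positivity)
    obtain ⟨N, hN⟩ := Metric.tendsto_atTop.1 hg0 (ε / 2) (by positivity)
    refine ⟨N, fun n hn => ?_⟩
    have h1 := hN n hn
    rw [Real.dist_eq, sub_zero, abs_of_nonneg (integral_nonneg fun ω => abs_nonneg _)] at h1 ⊢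
    have h2 := hle g (fun z => f z - g z) hg (hf.sub hg) n
    simp only [add_sub_cancel] at h2
    have h3 := hbound n (fun z => f z - g z) (hf.sub hg)
    have h4 : C * ∫ z, |f z - g z| ∂(Q.prod Q) ≤ ε / 2 := by
      calc C * ∫ z, |f z - g z| ∂(Q.prod Q) ≤ (C + 1) * (ε / (2 * (C + 1))) := by
            exact mul_le_mul (by linarith) hfg (integral_nonneg fun ω => abs_nonneg _) (by linarith)
        _ = ε / 2 := by field_simp
    linarith

/-! ### The weak law of large numbers for U-statistics. -/

section Statistics

variable {d : ℕ} (Q : Measure (Rd d)) [IsProbabilityMeasure Q]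

theorem integrable_eval_pair {f : Rd d × Rd d → ℝ} (hf : Integrable f (Q.prod Q)) {n : ℕ}
    {i j : Fin n} (hij : i ≠ j) :
    Integrable (fun x : Fin n → Rd d => f (x i, x j)) (Measure.pi fun _ => Q) :=
  (measurePreserving_eval_pair Q hij).integrable_comp_of_integrable hf

theorem integral_eval_pair {f : Rd d × Rd d → ℝ} (hf : Integrable f (Q.prod Q)) {n : ℕ}
    {i j : Fin n} (hij : i ≠ j) :
    ∫ x : Fin n → Rd d, f (x i, x j) ∂(Measure.pi fun _ => Q) = ∫ z, f z ∂(Q.prod Q) := by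
  rw [← (measurePreserving_eval_pair Q hij).map_eq,
    integral_map (measurePreserving_eval_pair Q hij).aemeasurable]
  rw [(measurePreserving_eval_pair Q hij).map_eq]
  exact hf.aestronglyMeasurable

theorem integrable_uStat {f : Rd d × Rd d → ℝ} (hf : Integrable f (Q.prod Q)) (n : ℕ) :
    Integrable (fun x : Fin n → Rd d => uStat (fun a b => f (a, b)) x)
      (Measure.pi fun _ => Q) := by
  refine Integrable.const_mul ?_ _
  refine integrable_finsetSum _ fun i _ => integrable_finsetSum _ fun j _ => ?_
  by_cases hij : i = j
  · simp [hij]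
  · simpa [hij] using integrable_eval_pair Q hf hij

theorem integral_abs_uStat_le {f : Rd d × Rd d → ℝ} (hf : Integrable f (Q.prod Q)) (n : ℕ) :
    ∫ x : Fin n → Rd d, |uStat (fun a b => f (a, b)) x| ∂(Measure.pi fun _ => Q)
      ≤ ∫ z, |f z| ∂(Q.prod Q) := by
  have h0 : 0 ≤ ∫ z, |f z| ∂(Q.prod Q) := integral_nonneg fun ω => abs_nonneg _
  have hint : ∀ i j : Fin n, Integrable (fun x : Fin n → Rd d =>
      if i ≠ j then |f (x i, x j)| else 0) (Measure.pi fun _ => Q) := by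
    intro i j
    by_cases hij : i = j
    · simp [hij]
    · simpa [hij] using (integrable_eval_pair Q hf hij).abs
  have hn0 : 0 ≤ 1 / (((n : ℝ) - 1) * n) := by
    rcases Nat.eq_zero_or_pos n with rfl | hn
    · simp
    · have : (1 : ℝ) ≤ n := by exact_mod_cast hn
      have : (0 : ℝ) ≤ n - 1 := by linarith
      positivity
  calc ∫ x : Fin n → Rd d, |uStat (fun a b => f (a, b)) x| ∂(Measure.pi fun _ => Q)
      ≤ ∫ x : Fin n → Rd d, 1 / (((n : ℝ) - 1) * n) *
          ∑ i, ∑ j, (if i ≠ j then |f (x i, x j)| else 0) ∂(Measure.pi fun _ => Q) := by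
        refine integral_mono (integrable_uStat Q hf n).abs ?_ fun x => ?_
        · exact (integrable_finsetSum _ fun i _ =>
            integrable_finsetSum _ fun j _ => hint i j).const_mul _
        · simp only [uStat, abs_mul, abs_of_nonneg hn0]
          refine mul_le_mul_of_nonneg_left ?_ hn0
          refine (Finset.abs_sum_le_sum_abs _ _).trans (Finset.sum_le_sum fun i _ => ?_)
          refine (Finset.abs_sum_le_sum_abs _ _).trans (Finset.sum_le_sum fun j _ => ?_)
          split_ifs <;> simp
    _ = 1 / (((n : ℝ) - 1) * n) *
          ∑ i : Fin n, ∑ j : Fin n, (if i ≠ j then ∫ z, |f z| ∂(Q.prod Q) else 0) := by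
        rw [integral_const_mul, integral_finsetSum _ fun i _ =>
            integrable_finsetSum _ fun j _ => hint i j]
        congr 1
        refine Finset.sum_congr rfl fun i _ => ?_
        rw [integral_finsetSum _ fun j _ => hint i j]
        refine Finset.sum_congr rfl fun j _ => ?_
        by_cases hij : i = j
        · simp [hij]
        · simpa [hij] using integral_eval_pair Q hf.abs hij
    _ ≤ ∫ z, |f z| ∂(Q.prod Q) := by
        have hsum : ∑ i : Fin n, ∑ j : Fin n, (if i ≠ j then ∫ z, |f z| ∂(Q.prod Q) else 0)
            = ((n : ℝ) - 1) * n * ∫ z, |f z| ∂(Q.prod Q) := by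
          have : ∀ i j : Fin n, (if i ≠ j then ∫ z, |f z| ∂(Q.prod Q) else 0)
              = ∫ z, |f z| ∂(Q.prod Q) - if i = j then ∫ z, |f z| ∂(Q.prod Q) else 0 := by
            intro i j; split_ifs <;> simp_all
          simp only [this, Finset.sum_sub_distrib, Finset.sum_ite_eq, Finset.mem_univ, if_true,
            Finset.sum_const, Finset.card_univ, Fintype.card_fin, nsmul_eq_mul]
          ring
        rw [hsum, ← mul_assoc]
        -- Only an inequality: for `n = 0` and `n = 1` the normalizing factor is `1 / 0 = 0`.
        refine mul_le_of_le_one_left h0 ?_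
        rw [one_div]
        exact inv_mul_le_one

theorem uStat_add {n : ℕ} (f g : Rd d → Rd d → ℝ) (x : Fin n → Rd d) :
    uStat (fun a b => f a b + g a b) x = uStat f x + uStat g x := by
  simp only [uStat]
  rw [← mul_add, ← Finset.sum_add_distrib]
  congr 1
  refine Finset.sum_congr rfl fun i _ => ?_
  rw [← Finset.sum_add_distrib]
  refine Finset.sum_congr rfl fun j _ => ?_
  split_ifs <;> simp

theorem uStat_const_mul {n : ℕ} (c : ℝ) (f : Rd d → Rd d → ℝ) (x : Fin n → Rd d) :
    uStat (fun a b => c * f a b) x = c * uStat f x := by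
  simp only [uStat]
  rw [mul_left_comm]
  congr 1
  rw [Finset.mul_sum]
  refine Finset.sum_congr rfl fun i _ => ?_
  rw [Finset.mul_sum]
  refine Finset.sum_congr rfl fun j _ => ?_
  split_ifs <;> simp

theorem bootStat_add {n : ℕ} (f g : Rd d → Rd d → ℝ) (x : Fin n → Rd d) (N : Fin n → ℕ) :
    bootStat (fun a b => f a b + g a b) x N = bootStat f x N + bootStat g x N := by
  simp only [bootStat]
  rw [← Finset.sum_add_distrib]
  refine Finset.sum_congr rfl fun i _ => ?_
  rw [← Finset.sum_add_distrib]
  refine Finset.sum_congr rfl fun j _ => ?_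
  split_ifs
  · ring
  · simp

theorem bootStat_const_mul {n : ℕ} (c : ℝ) (f : Rd d → Rd d → ℝ) (x : Fin n → Rd d)
    (N : Fin n → ℕ) : bootStat (fun a b => c * f a b) x N = c * bootStat f x N := by
  simp only [bootStat]
  rw [Finset.mul_sum]
  refine Finset.sum_congr rfl fun i _ => ?_
  rw [Finset.mul_sum]
  refine Finset.sum_congr rfl fun j _ => ?_
  split_ifs
  · ring
  · simp

/-- For a product kernel, both statistics become a product of two linear sums up to a diagonal
correction. -/
theorem sum_sum_ne_mul {n : ℕ} (a b : Fin n → ℝ) :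
    ∑ i, ∑ j, (if i ≠ j then a i * b j else 0) = (∑ i, a i) * (∑ j, b j) - ∑ i, a i * b i := by
  have : ∀ i j : Fin n, (if i ≠ j then a i * b j else 0)
      = a i * b j - if i = j then a i * b j else 0 := by
    intro i j; split_ifs <;> simp_all
  simp only [this, Finset.sum_sub_distrib, Finset.sum_ite_eq, Finset.mem_univ, if_true,
    Finset.sum_mul_sum]

theorem integrable_centered_sum_sq {A : Set (Rd d)} (hA : MeasurableSet A) (n : ℕ) :
    Integrable (fun x : Fin n → Rd d => (∑ i, A.indicator (fun _ => (1 : ℝ)) (x i)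
      - n * Q.real A) ^ 2) (Measure.pi fun _ => Q) := by
  refine Integrable.of_bound (C := ((2 : ℝ) * n) ^ 2) ?_ ?_
  · refine Measurable.aestronglyMeasurable ?_
    have h1 : Measurable (A.indicator fun _ => (1 : ℝ)) := measurable_const.indicator hA
    fun_prop
  · filter_upwards with x
    rw [Real.norm_eq_abs, abs_of_nonneg (sq_nonneg _), sq_le_sq, abs_of_nonneg (by positivity :
      (0 : ℝ) ≤ 2 * n)]
    refine (abs_sub _ _).trans ?_
    have h1 : |∑ i, A.indicator (fun _ => (1 : ℝ)) (x i)| ≤ n := by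
      refine (Finset.abs_sum_le_sum_abs _ _).trans ?_
      calc ∑ i, |A.indicator (fun _ => (1 : ℝ)) (x i)| ≤ ∑ _i : Fin n, (1 : ℝ) := by
            refine Finset.sum_le_sum fun i _ => ?_
            simp only [Set.indicator]; split_ifs <;> simp
        _ = n := by simp
    have h2 : |(n : ℝ) * Q.real A| ≤ n := by
      rw [abs_of_nonneg (by positivity)]
      exact mul_le_of_le_one_right (by positivity) measureReal_le_one
    linarith

theorem integral_centered_sum_sq_le {A : Set (Rd d)} (hA : MeasurableSet A) (n : ℕ) :
    ∫ x : Fin n → Rd d, (∑ i, A.indicator (fun _ => (1 : ℝ)) (x i) - n * Q.real A) ^ 2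
      ∂(Measure.pi fun _ => Q) ≤ n := by
  have h1 : Measurable (A.indicator fun _ => (1 : ℝ)) := measurable_const.indicator hA
  have hb : ∀ z, |A.indicator (fun _ => (1 : ℝ)) z| ≤ 1 := fun z => by
    simp only [Set.indicator]; split_ifs <;> simp
  have hL : MemLp (A.indicator fun _ => (1 : ℝ)) 2 Q :=
    MemLp.of_bound h1.aestronglyMeasurable 1 (Eventually.of_forall hb)
  have hvar := variance_sum_pi (μ := fun _ : Fin n => Q)
    (X := fun _ => A.indicator fun _ => (1 : ℝ)) fun _ => hL
  have hev : ∀ i : Fin n, ∫ x : Fin n → Rd d, A.indicator (fun _ => (1 : ℝ)) (x i)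
      ∂(Measure.pi fun _ => Q) = Q.real A := fun i => by
    have h2 := integral_map (μ := Measure.pi fun _ : Fin n => Q) (φ := Function.eval i)
      (f := A.indicator fun _ => (1 : ℝ)) (measurable_pi_apply i).aemeasurable
      h1.aestronglyMeasurable
    rw [(measurePreserving_eval (fun _ : Fin n => Q) i).map_eq, integral_indicator hA] at h2
    simpa using h2.symm
  have hmean : (Measure.pi fun _ : Fin n => Q)[∑ i : Fin n, fun x : Fin n → Rd d =>
      A.indicator (fun _ => (1 : ℝ)) (x i)] = n * Q.real A := by
    simp only [Finset.sum_apply]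
    rw [integral_finsetSum]
    · simp [hev]
    · exact fun i _ => Integrable.of_bound (h1.comp (measurable_pi_apply i)).aestronglyMeasurable
        1 (Eventually.of_forall fun x => hb _)
  rw [variance_eq_integral, hmean] at hvar
  · simp only [Finset.sum_apply] at hvar
    rw [hvar]
    calc ∑ _i : Fin n, Var[A.indicator fun _ => (1 : ℝ); Q] ≤ ∑ _i : Fin n, 1 := by
          refine Finset.sum_le_sum fun i _ => ?_
          refine (variance_le_expectation_sq h1.aestronglyMeasurable).trans ?_
          calc ∫ z, (A.indicator (fun _ => (1 : ℝ)) ^ 2) z ∂Q ≤ ∫ _, 1 ∂Q := by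
                refine integral_mono_of_nonneg (Eventually.of_forall fun z => sq_nonneg _)
                  (integrable_const _) (Eventually.of_forall fun z => ?_)
                simpa using hb z
            _ = 1 := by simp
      _ = n := by simp
  · refine Finset.aemeasurable_sum _ fun i _ => ?_
    exact (h1.comp (measurable_pi_apply i)).aemeasurable

theorem integral_add_mul_add_const {Ω : Type*} [MeasurableSpace Ω] {ν : Measure Ω}
    [IsProbabilityMeasure ν] {f g : Ω → ℝ} (hf : Integrable f ν) (hg : Integrable g ν)
    (r s t : ℝ) : ∫ x, (f x + g x) * r + s + t ∂ν = (∫ x, f x ∂ν + ∫ x, g x ∂ν) * r + s + t := by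
  rw [← integral_add hf hg, ← integral_mul_const, integral_add _ (integrable_const _),
    integral_add _ (integrable_const _)]
  · simp
  · exact (hf.add hg).mul_const r
  · exact ((hf.add hg).mul_const r).add (integrable_const _)

/-- Writing the two counts as `n α + V` and `n β + W`, the error has numerator `V W + n β V + n α W
+ n α β - c`, where `c` is the diagonal sum. The linear terms are absorbed by `n |v| ≤ (v² √n + n
√n) / 2`. As `V` and `W` have second moments at most `n`, the numerator has mean of order `n √n`,
against a denominator of order `n²`. -/
theorem abs_uStat_rect_sub_le {n : ℕ} (hn : 2 ≤ n) (A B : Set (Rd d)) (x : Fin n → Rd d) :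
    |uStat (fun a b => (A ×ˢ B).indicator (fun _ => (1 : ℝ)) (a, b)) x - Q.real A * Q.real B|
      ≤ (((∑ i, A.indicator (fun _ => (1 : ℝ)) (x i) - n * Q.real A) ^ 2
          + (∑ i, B.indicator (fun _ => (1 : ℝ)) (x i) - n * Q.real B) ^ 2) * (√n)
          + n * √n + 2 * n) / (((n : ℝ) - 1) * n) := by
  have hs : ∀ a b, (A ×ˢ B).indicator (fun _ => (1 : ℝ)) (a, b)
      = A.indicator (fun _ => 1) a * B.indicator (fun _ => 1) b := by
    intro a b
    by_cases ha : a ∈ A <;> by_cases hb : b ∈ B <;> simp [ha, hb]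
  simp only [uStat, hs, sum_sum_ne_mul]
  set s := ∑ i, A.indicator (fun _ => (1 : ℝ)) (x i)
  set t := ∑ i, B.indicator (fun _ => (1 : ℝ)) (x i)
  set c := ∑ i, A.indicator (fun _ => (1 : ℝ)) (x i) * B.indicator (fun _ => (1 : ℝ)) (x i)
    with hc
  have hα0 : 0 ≤ Q.real A := measureReal_nonneg
  have hα1 : Q.real A ≤ 1 := measureReal_le_one
  have hβ0 : 0 ≤ Q.real B := measureReal_nonneg
  have hβ1 : Q.real B ≤ 1 := measureReal_le_one
  have hc0 : 0 ≤ c := Finset.sum_nonneg fun i _ => mul_nonneg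
    (Set.indicator_nonneg (fun _ _ => zero_le_one) _)
    (Set.indicator_nonneg (fun _ _ => zero_le_one) _)
  have hcn : c ≤ n := by
    calc c ≤ ∑ _i : Fin n, (1 : ℝ) := by
          refine Finset.sum_le_sum fun i _ => ?_
          rw [← hs]
          simp only [Set.indicator]; split_ifs <;> simp
      _ = n := by simp
  set α := Q.real A
  set β := Q.real B
  have hn2 : (2 : ℝ) ≤ n := by exact_mod_cast hn
  set V := s - n * α with hV
  set W := t - n * β with hW
  have hden : 0 < ((n : ℝ) - 1) * n := by nlinarith
  have heq : 1 / (((n : ℝ) - 1) * n) * (s * t - c) - α * β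
      = (V * W + n * β * V + n * α * W + n * (α * β) - c) / (((n : ℝ) - 1) * n) := by
    rw [eq_div_iff hden.ne', sub_mul, one_div, mul_right_comm, inv_mul_cancel₀ hden.ne', hV, hW]
    ring
  rw [heq, abs_div, abs_of_pos hden]
  refine div_le_div_of_nonneg_right ?_ hden.le
  have hsq : √(n : ℝ) ^ 2 = n := Real.sq_sqrt (by positivity)
  have hs1 : 1 ≤ √(n : ℝ) := Real.one_le_sqrt.2 (by linarith)
  set r := √(n : ℝ)
  have hlin : ∀ v γ : ℝ, 0 ≤ γ → γ ≤ 1 → |n * γ * v| ≤ (v ^ 2 * r + n * r) / 2 := by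
    intro v γ h0 h1
    rw [abs_mul, abs_of_nonneg (by positivity)]
    calc n * γ * |v| ≤ n * 1 * |v| := by gcongr
      _ ≤ (v ^ 2 * r + n * r) / 2 := by
        rw [← hsq, ← sq_abs v]
        nlinarith [mul_nonneg (by linarith : 0 ≤ r) (sq_nonneg (|v| - r))]
  have h1 := hlin V β hβ0 hβ1
  have h2 := hlin W α hα0 hα1
  have h3 : |V * W| ≤ (V ^ 2 + W ^ 2) / 2 * r := by
    have h31 : |V * W| ≤ (V ^ 2 + W ^ 2) / 2 := by
      rw [abs_mul, ← sq_abs V, ← sq_abs W]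
      nlinarith [sq_nonneg (|V| - |W|)]
    exact h31.trans (le_mul_of_one_le_right (by positivity) hs1)
  have h4 : |n * (α * β) - c| ≤ 2 * n := by
    have : n * (α * β) ≤ n := mul_le_of_le_one_right (by positivity)
      (mul_le_one₀ hα1 hβ0 hβ1)
    have : 0 ≤ n * (α * β) := by positivity
    rw [abs_le]; constructor <;> linarith
  have h5 : V * W + n * β * V + n * α * W + n * (α * β) - c
      = V * W + n * β * V + n * α * W + (n * (α * β) - c) := by ring
  rw [h5]
  have h6 := abs_add_le (V * W + n * β * V + n * α * W) (n * (α * β) - c)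
  have h7 := abs_add_le (V * W + n * β * V) (n * α * W)
  have h8 := abs_add_le (V * W) (n * β * V)
  linarith

/-- The weak law of large numbers for U-statistics, in `L¹`. -/
theorem tendsto_integral_abs_uStat_sub {f : Rd d × Rd d → ℝ} (hf : Integrable f (Q.prod Q)) :
    Tendsto (fun n => ∫ x : Fin n → Rd d, |uStat (fun a b => f (a, b)) x - ∫ z, f z ∂(Q.prod Q)|
      ∂(Measure.pi fun _ => Q)) atTop (𝓝 0) := by
  -- The constant `2` accounts for the statistic and for the mean subtracted from it.
  refine tendsto_integral_abs_of_rect Q (Ω := fun n => Fin n → Rd d)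
    (fun n => Measure.pi fun _ => Q)
    (fun n f x => uStat (fun a b => f (a, b)) x - ∫ z, f z ∂(Q.prod Q)) 2 (by norm_num)
    ?_ ?_ ?_ ?_ ?_ f hf
  · intro n f g hf hg x
    rw [uStat_add, integral_add hf hg]
    ring
  · intro n c f x
    rw [uStat_const_mul, integral_const_mul]
    ring
  · exact fun n f hf => (integrable_uStat Q hf n).sub (integrable_const _)
  · intro n f hf
    have h1 := integral_abs_uStat_le Q hf n
    have h2 : |∫ z, f z ∂(Q.prod Q)| ≤ ∫ z, |f z| ∂(Q.prod Q) := abs_integral_le_integral_abs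
    calc ∫ x : Fin n → Rd d, |uStat (fun a b => f (a, b)) x - ∫ z, f z ∂(Q.prod Q)|
          ∂(Measure.pi fun _ => Q)
        ≤ ∫ x : Fin n → Rd d, (|uStat (fun a b => f (a, b)) x| + |∫ z, f z ∂(Q.prod Q)|)
          ∂(Measure.pi fun _ => Q) :=
          integral_mono ((integrable_uStat Q hf n).sub (integrable_const _)).abs
            ((integrable_uStat Q hf n).abs.add (integrable_const _)) fun x => abs_sub _ _
      _ ≤ 2 * ∫ z, |f z| ∂(Q.prod Q) := by
          rw [integral_add (integrable_uStat Q hf n).abs (integrable_const _)]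
          simp only [integral_const, probReal_univ, one_smul]
          linarith
  · intro A B hA hB
    have hint : ∫ z, (A ×ˢ B).indicator (fun _ => (1 : ℝ)) z ∂(Q.prod Q)
        = Q.real A * Q.real B := by
      rw [integral_indicator (hA.prod hB)]
      simp [measureReal_prod_prod]
    have hI : Integrable ((A ×ˢ B).indicator fun _ => (1 : ℝ)) (Q.prod Q) :=
      (integrable_const 1).indicator (hA.prod hB)
    simp only [hint]
    -- The mean numerator is at most `3 n √n + 2 n ≤ 5 n √n`, and `n - 1 ≥ n / 2` for `n ≥ 2`; hence
    -- `10 / √n`.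
    have hlim : Tendsto (fun n : ℕ => 10 / √(n : ℝ)) atTop (𝓝 0) :=
      tendsto_const_nhds.div_atTop (Real.tendsto_sqrt_atTop.comp tendsto_natCast_atTop_atTop)
    refine squeeze_zero' (Eventually.of_forall fun n => integral_nonneg fun x => abs_nonneg _)
      ?_ hlim
    filter_upwards [eventually_ge_atTop 2] with n hn
    have hIA := integrable_centered_sum_sq Q hA n
    have hIB := integrable_centered_sum_sq Q hB n
    have hn2 : (2 : ℝ) ≤ n := by exact_mod_cast hn
    have hden : 0 < ((n : ℝ) - 1) * n := by nlinarith
    have hs1 : 1 ≤ √(n : ℝ) := Real.one_le_sqrt.2 (by linarith)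
    have hsq : √(n : ℝ) ^ 2 = n := Real.sq_sqrt (by positivity)
    refine (integral_mono ((integrable_uStat Q hI n).sub (integrable_const _)).abs
      (((((hIA.add hIB).mul_const (√(n : ℝ))).add (integrable_const _)).add
        (integrable_const _)).div_const _) fun x => abs_uStat_rect_sub_le Q hn A B x).trans ?_
    simp only [Pi.add_apply]
    rw [integral_div, integral_add_mul_add_const hIA hIB]
    have h1 := integral_centered_sum_sq_le Q hA n
    have h2 := integral_centered_sum_sq_le Q hB n
    rw [div_le_div_iff₀ hden (by positivity)]
    set r := √(n : ℝ)
    calc _ ≤ (((n : ℝ) + n) * r + n * r + 2 * n) * r := by gcongr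
      _ ≤ 10 * (((n : ℝ) - 1) * n) := by
        have : (((n : ℝ) + n) * r + n * r + 2 * n) * r = 3 * n * n + 2 * n * r := by
          rw [← hsq]; ring
        have hrn : r ≤ n := by rw [← hsq]; nlinarith
        nlinarith

end Statistics

/-! ### The bootstrap statistic vanishes in `L¹`. -/

section Bootstrap

variable {d : ℕ} (Q : Measure (Rd d)) [IsProbabilityMeasure Q]

theorem integrable_bootStat_term {f : Rd d × Rd d → ℝ} (hf : Integrable f (Q.prod Q)) {n : ℕ}
    (i j : Fin n) :
    Integrable (fun ω : (Fin n → Rd d) × (Fin n → ℕ) => if i ≠ j then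
      ((ω.2 i : ℝ) / n - 1 / n) * f (ω.1 i, ω.1 j) * ((ω.2 j : ℝ) / n - 1 / n) else 0)
      ((Measure.pi fun _ => Q).prod (multinomialUniform n)) := by
  by_cases hij : i = j
  · simp [hij]
  · simp only [ne_eq, hij, not_false_eq_true, if_true]
    refine ((integrable_eval_pair Q hf hij).mul_prod (integrable_multinomialUniform fun N =>
      ((N i : ℝ) / n - 1 / n) * ((N j : ℝ) / n - 1 / n))).congr (Eventually.of_forall fun ω => ?_)
    simp only
    ring

theorem integrable_bootStat {f : Rd d × Rd d → ℝ} (hf : Integrable f (Q.prod Q)) (n : ℕ) :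
    Integrable (fun ω : (Fin n → Rd d) × (Fin n → ℕ) => bootStat (fun a b => f (a, b)) ω.1 ω.2)
      ((Measure.pi fun _ => Q).prod (multinomialUniform n)) :=
  integrable_finsetSum _ fun i _ => integrable_finsetSum _ fun j _ =>
    integrable_bootStat_term Q hf i j

/-- Weights and sample are independent, so each off-diagonal term splits into a weight moment times
`∫ |f|`; the weight moments add up to the mean of `(∑ i, |c i|) ^ 2`. -/
theorem integral_abs_bootStat_le {f : Rd d × Rd d → ℝ} (hf : Integrable f (Q.prod Q)) (n : ℕ) :
    ∫ ω : (Fin n → Rd d) × (Fin n → ℕ), |bootStat (fun a b => f (a, b)) ω.1 ω.2|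
      ∂((Measure.pi fun _ => Q).prod (multinomialUniform n)) ≤ 4 * ∫ z, |f z| ∂(Q.prod Q) := by
  have h0 : 0 ≤ ∫ z, |f z| ∂(Q.prod Q) := integral_nonneg fun ω => abs_nonneg _
  set c : (Fin n → ℕ) → Fin n → ℝ := fun N i => (N i : ℝ) / n - 1 / n with hc
  have hint := fun i j : Fin n => integrable_bootStat_term Q hf i j
  calc ∫ ω : (Fin n → Rd d) × (Fin n → ℕ), |bootStat (fun a b => f (a, b)) ω.1 ω.2|
        ∂((Measure.pi fun _ => Q).prod (multinomialUniform n))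
      ≤ ∫ ω : (Fin n → Rd d) × (Fin n → ℕ), ∑ i, ∑ j, |if i ≠ j then
          c ω.2 i * f (ω.1 i, ω.1 j) * c ω.2 j else 0|
        ∂((Measure.pi fun _ => Q).prod (multinomialUniform n)) := by
        refine integral_mono (integrable_bootStat Q hf n).abs ?_ fun ω => ?_
        · exact integrable_finsetSum _ fun i _ => integrable_finsetSum _ fun j _ => (hint i j).abs
        · exact (Finset.abs_sum_le_sum_abs _ _).trans
            (Finset.sum_le_sum fun i _ => Finset.abs_sum_le_sum_abs _ _)
    _ = ∑ i, ∑ j, ∫ ω : (Fin n → Rd d) × (Fin n → ℕ), |if i ≠ j then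
          c ω.2 i * f (ω.1 i, ω.1 j) * c ω.2 j else 0|
        ∂((Measure.pi fun _ => Q).prod (multinomialUniform n)) := by
        rw [integral_finsetSum _ fun i _ => integrable_finsetSum _ fun j _ => (hint i j).abs]
        exact Finset.sum_congr rfl fun i _ => integral_finsetSum _ fun j _ => (hint i j).abs
    _ ≤ ∑ i, ∑ j, (∫ N, |c N i| * |c N j| ∂multinomialUniform n) * ∫ z, |f z| ∂(Q.prod Q) := by
        refine Finset.sum_le_sum fun i _ => Finset.sum_le_sum fun j _ => ?_
        by_cases hij : i = j
        · simp only [hij, ne_eq, not_true_eq_false, if_false, abs_zero, integral_zero]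
          exact mul_nonneg (integral_nonneg fun N => by positivity) h0
        · simp only [ne_eq, hij, not_false_eq_true, if_true]
          refine le_of_eq ?_
          rw [← integral_eval_pair Q hf.abs hij, mul_comm, ← integral_prod_mul]
          refine integral_congr_ae (Eventually.of_forall fun ω => ?_)
          simp only [abs_mul]
          ring
    _ = (∫ N, (∑ i, |c N i|) * (∑ j, |c N j|) ∂multinomialUniform n)
          * ∫ z, |f z| ∂(Q.prod Q) := by
        simp only [Finset.sum_mul_sum]
        rw [integral_finsetSum _ fun _ _ => integrable_multinomialUniform _, Finset.sum_mul]
        refine Finset.sum_congr rfl fun i _ => ?_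
        rw [integral_finsetSum _ fun _ _ => integrable_multinomialUniform _, Finset.sum_mul]
    _ ≤ 4 * ∫ z, |f z| ∂(Q.prod Q) := by
        refine mul_le_mul_of_nonneg_right ?_ h0
        calc ∫ N, (∑ i, |c N i|) * (∑ j, |c N j|) ∂multinomialUniform n
            ≤ ∫ _, 4 ∂multinomialUniform n := by
              refine integral_mono_ae (integrable_multinomialUniform _)
                (integrable_multinomialUniform _) ?_
              filter_upwards [ae_sum_abs_weight_le n] with N hN
              have : 0 ≤ ∑ i, |c N i| := Finset.sum_nonneg fun i _ => abs_nonneg _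
              nlinarith
          _ = 4 := by simp

/-- For a rectangle the statistic is a product of two centered linear forms in the weights minus a
diagonal at most `∑ i, (c i) ^ 2` in absolute value. The second moments of the forms and the mean of
this sum are each at most `1 / n`, whatever the sample. -/
theorem integral_abs_bootStat_rect_le {n : ℕ} (A B : Set (Rd d)) (x : Fin n → Rd d) :
    ∫ N, |bootStat (fun a b => (A ×ˢ B).indicator (fun _ => (1 : ℝ)) (a, b)) x N|
      ∂multinomialUniform n ≤ 2 / n := by
  rcases Nat.eq_zero_or_pos n with rfl | hn
  · simp [bootStat]
  have hs : ∀ a b, (A ×ˢ B).indicator (fun _ => (1 : ℝ)) (a, b)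
      = A.indicator (fun _ => 1) a * B.indicator (fun _ => 1) b := by
    intro a b
    by_cases ha : a ∈ A <;> by_cases hb : b ∈ B <;> simp [ha, hb]
  set a : Fin n → ℝ := fun i => A.indicator (fun _ => (1 : ℝ)) (x i)
  set b : Fin n → ℝ := fun i => B.indicator (fun _ => (1 : ℝ)) (x i)
  have hind : ∀ (D : Set (Rd d)) y, 0 ≤ D.indicator (fun _ => (1 : ℝ)) y ∧
      D.indicator (fun _ => (1 : ℝ)) y ≤ 1 := by
    intro D y
    simp only [Set.indicator]; split_ifs <;> simp
  set c : (Fin n → ℕ) → Fin n → ℝ := fun N i => (N i : ℝ) / n - 1 / n with hc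
  have hboot : ∀ N, bootStat (fun a b => (A ×ˢ B).indicator (fun _ => (1 : ℝ)) (a, b)) x N
      = (∑ i, c N i * a i) * (∑ i, c N i * b i) - ∑ i, (c N i * a i) * (c N i * b i) := by
    intro N
    rw [← sum_sum_ne_mul]
    simp only [bootStat, hs]
    refine Finset.sum_congr rfl fun i _ => Finset.sum_congr rfl fun j _ => ?_
    split_ifs
    · simp only [hc, a, b]; ring
    · rfl
  -- Each weight is itself a linear form, with Kronecker coefficients, so the same variance bound
  -- applies to it.
  have hδ : ∀ N, ∑ i, (c N i) ^ 2 = ∑ i, (∑ j, c N j * (if j = i then 1 else 0)) ^ 2 := by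
    intro N; simp
  have hpt : ∀ N, |bootStat (fun a b => (A ×ˢ B).indicator (fun _ => (1 : ℝ)) (a, b)) x N|
      ≤ (∑ i, c N i * a i) ^ 2 / 2 + (∑ i, c N i * b i) ^ 2 / 2
        + ∑ i, (∑ j, c N j * (if j = i then 1 else 0)) ^ 2 := by
    intro N
    rw [hboot, ← hδ]
    refine (abs_sub _ _).trans (add_le_add ?_ ?_)
    · rw [abs_mul, ← sq_abs (∑ i, c N i * a i), ← sq_abs (∑ i, c N i * b i)]
      nlinarith [sq_nonneg (|∑ i, c N i * a i| - |∑ i, c N i * b i|)]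
    · refine (Finset.abs_sum_le_sum_abs _ _).trans (Finset.sum_le_sum fun i _ => ?_)
      have h1 := hind A (x i)
      have h2 := hind B (x i)
      have h3 : |a i * b i| ≤ 1 := by
        rw [abs_of_nonneg (mul_nonneg h1.1 h2.1)]
        exact mul_le_one₀ h1.2 h2.1 h2.2
      calc |c N i * a i * (c N i * b i)| = (c N i) ^ 2 * |a i * b i| := by
            rw [show c N i * a i * (c N i * b i) = (c N i) ^ 2 * (a i * b i) by ring, abs_mul,
              abs_of_nonneg (sq_nonneg (c N i))]
        _ ≤ (c N i) ^ 2 := mul_le_of_le_one_right (sq_nonneg _) h3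
  have hn' : (n : ℝ) ≠ 0 := by positivity
  have hone : ∀ e : Fin n → ℝ, (∀ i, 0 ≤ e i ∧ e i ≤ 1) →
      ∫ N, (∑ i, c N i * e i) ^ 2 ∂multinomialUniform n ≤ 1 / (n : ℝ) := by
    intro e he
    refine (integral_sq_multinomialUniform_le e).trans ?_
    calc (∑ i, e i ^ 2) / (n : ℝ) ^ 2 ≤ (∑ _i : Fin n, (1 : ℝ)) / (n : ℝ) ^ 2 := by
          refine div_le_div_of_nonneg_right (Finset.sum_le_sum fun i _ => ?_) (by positivity)
          exact pow_le_one₀ (he i).1 (he i).2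
      _ = 1 / (n : ℝ) := by
          simp only [Finset.sum_const, Finset.card_univ, Fintype.card_fin, nsmul_eq_mul]
          field_simp
  have hsingle : ∀ i : Fin n, ∫ N, (∑ j, c N j * (if j = i then 1 else 0)) ^ 2
      ∂multinomialUniform n ≤ 1 / (n : ℝ) ^ 2 := by
    intro i
    refine (integral_sq_multinomialUniform_le fun j => if j = i then (1 : ℝ) else 0).trans_eq ?_
    simp
  have hI := fun g : (Fin n → ℕ) → ℝ => integrable_multinomialUniform g
  calc _ ≤ ∫ N, ((∑ i, c N i * a i) ^ 2 / 2 + (∑ i, c N i * b i) ^ 2 / 2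
        + ∑ i, (∑ j, c N j * (if j = i then 1 else 0)) ^ 2) ∂multinomialUniform n :=
        integral_mono (hI _) (hI _) hpt
    _ = (∫ N, (∑ i, c N i * a i) ^ 2 ∂multinomialUniform n) / 2
        + (∫ N, (∑ i, c N i * b i) ^ 2 ∂multinomialUniform n) / 2
        + ∑ i, ∫ N, (∑ j, c N j * (if j = i then 1 else 0)) ^ 2 ∂multinomialUniform n := by
        rw [integral_add (hI _) (hI _), integral_add (hI _) (hI _), integral_div, integral_div,
          integral_finsetSum _ fun _ _ => hI _]
    _ ≤ 1 / n / 2 + 1 / n / 2 + ∑ _i : Fin n, 1 / (n : ℝ) ^ 2 := by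
        have h1 := hone a fun i => hind A (x i)
        have h2 := hone b fun i => hind B (x i)
        have h3 := Finset.sum_le_sum fun (i : Fin n) (_ : i ∈ Finset.univ) => hsingle i
        linarith
    _ = 2 / n := by
        simp only [Finset.sum_const, Finset.card_univ, Fintype.card_fin, nsmul_eq_mul]
        field_simp
        norm_num

/-- The bootstrap statistic of an integrable kernel converges to zero in `L¹`. -/
theorem tendsto_integral_abs_bootStat {f : Rd d × Rd d → ℝ} (hf : Integrable f (Q.prod Q)) :
    Tendsto (fun n => ∫ ω : (Fin n → Rd d) × (Fin n → ℕ),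
      |bootStat (fun a b => f (a, b)) ω.1 ω.2|
        ∂((Measure.pi fun _ => Q).prod (multinomialUniform n))) atTop (𝓝 0) := by
  refine tendsto_integral_abs_of_rect Q (Ω := fun n => (Fin n → Rd d) × (Fin n → ℕ))
    (fun n => (Measure.pi fun _ => Q).prod (multinomialUniform n))
    (fun n f ω => bootStat (fun a b => f (a, b)) ω.1 ω.2) 4 (by norm_num)
    ?_ ?_ ?_ ?_ ?_ f hf
  · exact fun n f g _ _ ω => bootStat_add _ _ _ _
  · exact fun n c f ω => bootStat_const_mul _ _ _ _
  · exact fun n f hf => integrable_bootStat Q hf n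
  · exact fun n f hf => integral_abs_bootStat_le Q hf n
  · intro A B hA hB
    have hI : Integrable ((A ×ˢ B).indicator fun _ => (1 : ℝ)) (Q.prod Q) :=
      (integrable_const 1).indicator (hA.prod hB)
    refine squeeze_zero (fun n => integral_nonneg fun ω => abs_nonneg _) (fun n => ?_)
      (tendsto_const_div_atTop_nhds_zero_nat 2)
    have hb := (integrable_bootStat Q hI n).abs
    rw [integral_prod _ hb]
    calc _ ≤ ∫ _ : Fin n → Rd d, 2 / (n : ℝ) ∂(Measure.pi fun _ => Q) :=
          integral_mono hb.integral_prod_left (integrable_const _)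
            fun x => integral_abs_bootStat_rect_le A B x
      _ = 2 / n := by simp

end Bootstrap

/-! ### From `L¹` convergence to consistency of the test. -/

section Test

theorem empQuantile_le {m : ℕ} (hm : 1 ≤ m) {β t : ℝ} (hβ : 0 < β) (s : Fin m → ℝ)
    (ht : β ≤ ((Finset.univ.filter fun b => s b ≤ t).card : ℝ) / m) : empQuantile β s ≤ t := by
  -- A real infimum needs a lower bound: as `β > 0`, each admissible `u` is at least some `s b`.
  refine csInf_le ⟨-∑ b, |s b|, fun u hu => ?_⟩ ht
  have hpos : 0 < ((Finset.univ.filter fun b => s b ≤ u).card : ℝ) := by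
    have hm' : (0 : ℝ) < m := by exact_mod_cast hm
    have := hβ.trans_le hu
    rwa [div_pos_iff_of_pos_right hm'] at this
  obtain ⟨b, hb⟩ := Finset.card_pos.1 (by exact_mod_cast hpos)
  have h1 := (Finset.mem_filter.1 hb).2
  have h2 : |s b| ≤ ∑ b, |s b| :=
    Finset.single_le_sum (f := fun b => |s b|) (fun i _ => abs_nonneg _) (Finset.mem_univ b)
  linarith [neg_abs_le (s b)]

/-- Markov's inequality for the empirical distribution: at most `α m` of the values exceed `t`. -/
theorem empQuantile_le_of_sum_abs_lt {m : ℕ} (hm : 1 ≤ m) {α t : ℝ} (hα : α < 1) (ht : 0 < t)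
    (s : Fin m → ℝ) (hs : (∑ b, |s b|) / m < α * t) : empQuantile (1 - α) s ≤ t := by
  refine empQuantile_le hm (by linarith) s ?_
  have hm' : (0 : ℝ) < m := by exact_mod_cast hm
  rw [div_lt_iff₀ hm'] at hs
  rw [le_div_iff₀ hm']
  have hcard : ((Finset.univ.filter fun b => s b ≤ t).card : ℝ)
      = m - ((Finset.univ.filter fun b => ¬ s b ≤ t).card : ℝ) := by
    have := Finset.card_filter_add_card_filter_not (s := (Finset.univ : Finset (Fin m)))
      (fun b => s b ≤ t)
    rw [Finset.card_univ, Fintype.card_fin] at this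
    rw [eq_sub_iff_add_eq]
    exact_mod_cast this
  have hmark : ((Finset.univ.filter fun b => ¬ s b ≤ t).card : ℝ) * t ≤ ∑ b, |s b| := by
    calc ((Finset.univ.filter fun b => ¬ s b ≤ t).card : ℝ) * t
        = ∑ b ∈ Finset.univ.filter fun b => ¬ s b ≤ t, t := by simp
      _ ≤ ∑ b ∈ Finset.univ.filter fun b => ¬ s b ≤ t, |s b| := by
          refine Finset.sum_le_sum fun b hb => ?_
          exact (not_le.1 (Finset.mem_filter.1 hb).2).le.trans (le_abs_self _)
      _ ≤ ∑ b, |s b| := Finset.sum_le_sum_of_subset_of_nonneg (Finset.filter_subset _ _)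
          fun b _ _ => abs_nonneg _
  have : ((Finset.univ.filter fun b => ¬ s b ≤ t).card : ℝ) ≤ α * m := by
    refine le_of_mul_le_mul_right ?_ ht
    linarith
  rw [hcard]
  linarith

theorem isProbabilityMeasure_densityMeasure {d : ℕ} {q : Rd d → ℝ} (hq : IsProbDensity q) :
    IsProbabilityMeasure (densityMeasure q) :=
  ⟨by rw [densityMeasure, withDensity_apply _ .univ, Measure.restrict_univ, hq.lintegral_eq_one]⟩

/-- Subadditivity suffices, so measurability of the rejection events is never needed. -/
theorem tendsto_measure_one_of_compl_le {Ω : ℕ → Type*} [∀ n, MeasurableSpace (Ω n)]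
    (ν : ∀ n, Measure (Ω n)) [∀ n, IsProbabilityMeasure (ν n)] (E : ∀ n, Set (Ω n)) (b : ℕ → ℝ)
    (hb : Tendsto b atTop (𝓝 0)) (h : ∀ n, ν n (E n)ᶜ ≤ ENNReal.ofReal (b n)) :
    Tendsto (fun n => ν n (E n)) atTop (𝓝 1) := by
  have hlow : Tendsto (fun n => 1 - ENNReal.ofReal (b n)) atTop (𝓝 1) := by
    have h1 : Tendsto (fun n => ENNReal.ofReal (b n)) atTop (𝓝 0) := by
      simpa using ENNReal.tendsto_ofReal hb
    have := ENNReal.Tendsto.sub (tendsto_const_nhds (x := (1 : ENNReal))) h1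
      (Or.inl ENNReal.one_ne_top)
    simpa using this
  refine tendsto_of_tendsto_of_tendsto_of_le_of_le hlow tendsto_const_nhds (fun n => ?_)
    fun n => prob_le_one
  refine tsub_le_iff_right.2 ?_
  calc (1 : ENNReal) = ν n (E n ∪ (E n)ᶜ) := by simp
    _ ≤ ν n (E n) + ν n (E n)ᶜ := measure_union_le _ _
    _ ≤ ν n (E n) + ENNReal.ofReal (b n) := by gcongr; exact h n

/-- The bootstrap test based on a kernel of positive mean rejects with probability tending to
one. -/
theorem tendsto_testLaw_of_integral_pos {d : ℕ} {q : Rd d → ℝ} (hq : IsProbDensity q)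
    (h : Rd d → Rd d → ℝ)
    (hint : Integrable (fun z : Rd d × Rd d => h z.1 z.2)
      ((densityMeasure q).prod (densityMeasure q)))
    (hpos : 0 < ∫ z : Rd d × Rd d, h z.1 z.2 ∂((densityMeasure q).prod (densityMeasure q)))
    {α : ℝ} (hα : α ∈ Set.Ioo (0 : ℝ) 1) (m : ℕ → ℕ) (hm : ∀ n, 1 ≤ m n) :
    Tendsto (fun n => testLaw q n (m n) {ω | critValue h α ω.1 ω.2 < uStat h ω.1})
      atTop (𝓝 1) := by
  have hQ := isProbabilityMeasure_densityMeasure hq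
  set Q := densityMeasure q
  set S := ∫ z : Rd d × Rd d, h z.1 z.2 ∂(Q.prod Q)
  have hU := tendsto_integral_abs_uStat_sub Q hint
  have hB := tendsto_integral_abs_bootStat Q hint
  have htest : ∀ n, IsProbabilityMeasure (testLaw q n (m n)) := fun n => by
    unfold testLaw; infer_instance
  set u : ℕ → ℝ := fun n => ∫ x : Fin n → Rd d, |uStat h x - S| ∂(Measure.pi fun _ => Q)
  set v : ℕ → ℝ := fun n => ∫ ω : (Fin n → Rd d) × (Fin n → ℕ), |bootStat h ω.1 ω.2|
    ∂((Measure.pi fun _ => Q).prod (multinomialUniform n))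
  refine tendsto_measure_one_of_compl_le _ _ (fun n => u n / (S / 2) + v n / (α * (S / 4))) ?_ ?_
  · simpa using (hU.div_const (S / 2)).add (hB.div_const (α * (S / 4)))
  intro n
  have hm' : (0 : ℝ) < m n := by exact_mod_cast hm n
  have hαS : 0 < α * (S / 4) := mul_pos hα.1 (by linarith)
  have hUint : Integrable (fun ω : (Fin n → Rd d) × (Fin (m n) → Fin n → ℕ) =>
      |uStat h ω.1 - S|) (testLaw q n (m n)) :=
    ((integrable_uStat Q hint n).sub (integrable_const S)).abs.comp_fst _
  have hUeq : ∫ ω, |uStat h ω.1 - S| ∂testLaw q n (m n) = u n := by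
    simp only [testLaw]
    rw [integral_fun_fst (f := fun x => |uStat h x - S|)]
    simp [u, Q]
  -- The pair formed by the sample and one replicate has the same law for every `b`, so averaging
  -- over the replicates leaves the mean `v n` unchanged.
  have hmp : ∀ b : Fin (m n), MeasurePreserving
      (fun ω : (Fin n → Rd d) × (Fin (m n) → Fin n → ℕ) => (ω.1, ω.2 b)) (testLaw q n (m n))
      ((Measure.pi fun _ => Q).prod (multinomialUniform n)) := fun b =>
    (MeasurePreserving.id _).prod (measurePreserving_eval (fun _ => multinomialUniform n) b)
  have hBint : ∀ b : Fin (m n), Integrable (fun ω : (Fin n → Rd d) × (Fin (m n) → Fin n → ℕ) =>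
      |bootStat h ω.1 (ω.2 b)|) (testLaw q n (m n)) := fun b =>
    (hmp b).integrable_comp_of_integrable (integrable_bootStat Q hint n).abs
  have hBeq : ∀ b : Fin (m n), ∫ ω, |bootStat h ω.1 (ω.2 b)| ∂testLaw q n (m n) = v n := by
    intro b
    have h1 := integral_map (μ := testLaw q n (m n)) (hmp b).aemeasurable
      (f := fun ω : (Fin n → Rd d) × (Fin n → ℕ) => |bootStat h ω.1 ω.2|)
      (by rw [(hmp b).map_eq]; exact (integrable_bootStat Q hint n).abs.aestronglyMeasurable)
    rw [(hmp b).map_eq] at h1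
    exact h1.symm
  have hsub : {ω | critValue h α ω.1 ω.2 < uStat h ω.1}ᶜ
      ⊆ {ω : (Fin n → Rd d) × (Fin (m n) → Fin n → ℕ) | S / 2 ≤ |uStat h ω.1 - S|} ∪
        {ω | α * (S / 4) ≤ (∑ b, |bootStat h ω.1 (ω.2 b)|) / m n} := by
    intro ω hω
    by_contra hcon
    simp only [Set.mem_union, Set.mem_ofPred_eq, not_or, not_le] at hcon
    refine hω ?_
    have h1 : critValue h α ω.1 ω.2 ≤ S / 4 :=
      empQuantile_le_of_sum_abs_lt (hm n) hα.2 (by linarith) _ hcon.2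
    have h2 := (abs_lt.1 hcon.1).1
    simp only [Set.mem_ofPred_eq]
    linarith
  have hmarkov : ∀ {g : (Fin n → Rd d) × (Fin (m n) → Fin n → ℕ) → ℝ} {t : ℝ}, 0 < t →
      (∀ ω, 0 ≤ g ω) → Integrable g (testLaw q n (m n)) →
      testLaw q n (m n) {ω | t ≤ g ω} ≤ ENNReal.ofReal ((∫ ω, g ω ∂testLaw q n (m n)) / t) := by
    intro g t ht h0 hg
    have h1 := mul_meas_ge_le_integral_of_nonneg (Eventually.of_forall h0) hg t
    rw [← ofReal_measureReal]
    exact ENNReal.ofReal_le_ofReal ((le_div_iff₀' ht).2 h1)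
  have hv0 : 0 ≤ v n := integral_nonneg fun ω => abs_nonneg _
  have hu0 : 0 ≤ u n := integral_nonneg fun ω => abs_nonneg _
  refine (measure_mono hsub).trans ((measure_union_le _ _).trans ?_)
  rw [ENNReal.ofReal_add (by positivity) (by positivity)]
  refine add_le_add ?_ ?_
  · have := hmarkov (by linarith : 0 < S / 2) (fun ω => abs_nonneg (uStat h ω.1 - S)) hUint
    rwa [hUeq] at this
  · have := hmarkov hαS (g := fun ω => (∑ b, |bootStat h ω.1 (ω.2 b)|) / m n)
      (fun ω => by positivity) ((integrable_finsetSum _ fun b _ => hBint b).div_const _)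
    rw [integral_div, integral_finsetSum _ fun b _ => hBint b] at this
    simp only [hBeq, Finset.sum_const, Finset.card_univ, Fintype.card_fin, nsmul_eq_mul] at this
    rwa [mul_div_cancel_left₀ _ hm'.ne'] at this

end Test

/-! ### Hilbert space realization of the kernel. -/

section FeatureMap

/-- A positive definite kernel is the Gram kernel of a map into a Hilbert space. -/
theorem IsPDKernel.exists_featureMap {d : ℕ} {k : Rd d → Rd d → ℝ} (hk : IsPDKernel k) :
    ∃ (H : Type) (_ : NormedAddCommGroup H) (_ : InnerProductSpace ℝ H) (_ : CompleteSpace H)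
      (Φ : Rd d → H), ∀ x y, inner ℝ (Φ x) (Φ y) = k x y := by
  -- The scalar kernel is viewed as operator-valued on `ℝ`; the features are its kernel functions
  -- applied to `1`.
  let K : Matrix (Rd d) (Rd d) (ℝ →L[ℝ] ℝ) :=
    Matrix.of fun x y => k x y • ContinuousLinearMap.id ℝ ℝ
  have hK : K.PosSemidef := by
    have htfae : K.PosSemidef ↔ K.IsHermitian ∧ ∀ v : Rd d →₀ ℝ,
        0 ≤ RCLike.re (v.sum fun x w => v.sum fun x' w' => inner ℝ (K x' x w) w') :=
      RKHS.posSemidef_tfae.out 0 2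
    refine htfae.2 ⟨?_, fun v => ?_⟩
    · ext x y
      simp [K, Matrix.conjTranspose_apply, hk.symm x y, ContinuousLinearMap.star_eq_adjoint,
        ContinuousLinearMap.adjoint_id]
    · have h1 := hk.nonneg v.support.card (fun i => (v.support.equivFin.symm i : Rd d))
        (fun i => v (v.support.equivFin.symm i : Rd d))
      have h2 : ∀ F : Rd d → ℝ, ∑ i, F (v.support.equivFin.symm i : Rd d) = ∑ x ∈ v.support, F x :=
        fun F => by
          rw [← Finset.sum_coe_sort v.support]
          exact Equiv.sum_comp v.support.equivFin.symm fun x => F (x : Rd d)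
      change 0 ≤ ∑ x ∈ v.support, ∑ y ∈ v.support, inner ℝ (k y x * v x) (v y)
      rw [h2 fun x => ∑ j, v x * v (v.support.equivFin.symm j : Rd d) *
        k x (v.support.equivFin.symm j : Rd d)] at h1
      have h3 := fun x => h2 fun y => v x * v y * k x y
      simp only [h3] at h1
      convert h1 using 1
      refine Finset.sum_congr rfl fun x _ => Finset.sum_congr rfl fun y _ => ?_
      simp [hk.symm y x]
      ring
  have : Fact K.PosSemidef := ⟨hK⟩
  refine ⟨RKHS.OfKernel K, inferInstance, inferInstance, inferInstance,
    fun x => RKHS.kerFun (RKHS.OfKernel K) x 1, fun x y => ?_⟩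
  rw [← RKHS.kernel_inner, RKHS.OfKernel.kernel_ofKernel]
  simp [K, hk.symm y x]

/-- Expanding the square, `‖Φ y - Φ x‖² = k y y - 2 k y x + k x x`, which is continuous in `y` and
vanishes at `x`. -/
theorem continuous_featureMap {d : ℕ} {k : Rd d → Rd d → ℝ} {H : Type*} [NormedAddCommGroup H]
    [InnerProductSpace ℝ H] {Φ : Rd d → H} (hΦ : ∀ x y, inner ℝ (Φ x) (Φ y) = k x y)
    (hk : Continuous fun z : Rd d × Rd d => k z.1 z.2) : Continuous Φ := by
  refine continuous_iff_continuousAt.2 fun x => tendsto_iff_norm_sub_tendsto_zero.2 ?_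
  have h1 : ∀ y, ‖Φ y - Φ x‖ = √(k y y - 2 * k y x + k x x) := by
    intro y
    rw [← hΦ, ← hΦ, ← hΦ, real_inner_self_eq_norm_sq, real_inner_self_eq_norm_sq,
      ← norm_sub_sq_real, Real.sqrt_sq (norm_nonneg _)]
  have h2 : Continuous fun y => √(k y y - 2 * k y x + k x x) := by
    have a1 : Continuous fun y => k y y := hk.comp (continuous_id.prodMk continuous_id)
    have a2 : Continuous fun y => k y x := hk.comp (continuous_id.prodMk continuous_const)
    fun_prop
  simp only [h1]
  have h3 := h2.tendsto x
  convert h3 using 2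
  rw [show k x x - 2 * k x x + k x x = 0 by ring, Real.sqrt_zero]

end FeatureMap

/-! ### Differentiation under the integral sign. -/

section ParametricIntegral

theorem hasFDerivAt_comp_fst {E F : Type*} [NormedAddCommGroup E] [NormedSpace ℝ E]
    [NormedAddCommGroup F] [NormedSpace ℝ F] {b : E × F → ℝ} (hb : ContDiff ℝ 1 b) (x : E) (y : F) :
    HasFDerivAt (fun z => b (z, y)) ((fderiv ℝ b (x, y)).comp (.inl ℝ E F)) x :=
  ((hb.differentiable one_ne_zero) (x, y)).hasFDerivAt.comp x (hasFDerivAt_prodMk_left x y)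

/-- Differentiation under the integral sign against an integrable function vanishing outside a
compact set. -/
theorem hasFDerivAt_integral_mul {d : ℕ} {g : Rd d → ℝ} (hg : Integrable g) {K : Set (Rd d)}
    (hK : IsCompact K) (hgK : ∀ y, y ∉ K → g y = 0) {b : Rd d × Rd d → ℝ} (hb : ContDiff ℝ 1 b) :
    (∀ x, HasFDerivAt (fun x => ∫ y, g y * b (x, y))
      (∫ y, g y • (fderiv ℝ b (x, y)).comp (.inl ℝ (Rd d) (Rd d))) x) ∧
    (∀ x, Integrable fun y => g y • (fderiv ℝ b (x, y)).comp (.inl ℝ (Rd d) (Rd d))) ∧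
    Continuous (fun x => ∫ y, g y • (fderiv ℝ b (x, y)).comp (.inl ℝ (Rd d) (Rd d))) := by
  have hb' : Continuous fun z : Rd d × Rd d => (fderiv ℝ b z).comp (.inl ℝ (Rd d) (Rd d)) :=
    (hb.continuous_fderiv one_ne_zero).clm_comp continuous_const
  have hbound : ∀ x₀ : Rd d, ∃ C, ∀ x ∈ Metric.closedBall x₀ 1, ∀ y,
      ‖g y • (fderiv ℝ b (x, y)).comp (.inl ℝ (Rd d) (Rd d))‖ ≤ ‖g y‖ * C := by
    intro x₀
    obtain ⟨C, hC⟩ := ((isCompact_closedBall x₀ 1).prod hK).exists_bound_of_continuousOn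
      hb'.continuousOn
    refine ⟨C, fun x hx y => ?_⟩
    by_cases hy : y ∈ K
    · rw [norm_smul]
      exact mul_le_mul_of_nonneg_left (hC (x, y) ⟨hx, hy⟩) (norm_nonneg _)
    · simp [hgK y hy]
  have hmeas : ∀ x, AEStronglyMeasurable
      (fun y => g y • (fderiv ℝ b (x, y)).comp (.inl ℝ (Rd d) (Rd d))) volume := fun x =>
    hg.aestronglyMeasurable.smul
      (hb'.comp (continuous_const.prodMk continuous_id)).aestronglyMeasurable
  have hint : ∀ x, Integrable fun y => g y • (fderiv ℝ b (x, y)).comp (.inl ℝ (Rd d) (Rd d)) := by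
    intro x
    obtain ⟨C, hC⟩ := hbound x
    exact (hg.norm.mul_const C).mono' (hmeas x)
      (Eventually.of_forall fun y => hC x (Metric.mem_closedBall_self zero_le_one) y)
  refine ⟨fun x₀ => ?_, hint, continuous_iff_continuousAt.2 fun x₀ => ?_⟩
  · obtain ⟨C, hC⟩ := hbound x₀
    have hbc : ∀ x, Continuous fun y => b (x, y) := fun x =>
      hb.continuous.comp (continuous_const.prodMk continuous_id)
    refine hasFDerivAt_integral_of_dominated_of_fderiv_le (bound := fun y => ‖g y‖ * C)
      (Metric.closedBall_mem_nhds x₀ one_pos)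
      (Eventually.of_forall fun x => hg.aestronglyMeasurable.mul (hbc x).aestronglyMeasurable)
      ?_ (hmeas x₀) (Eventually.of_forall fun y x hx => hC x hx y) (hg.norm.mul_const C)
      (Eventually.of_forall fun y x _ => (hasFDerivAt_comp_fst hb x y).const_mul (g y))
    obtain ⟨C', hC'⟩ := hK.exists_bound_of_continuousOn (hbc x₀).continuousOn
    refine (hg.norm.mul_const C').mono' (hg.aestronglyMeasurable.mul
      (hbc x₀).aestronglyMeasurable) (Eventually.of_forall fun y => ?_)
    by_cases hy : y ∈ K
    · rw [Pi.mul_apply, norm_mul]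
      exact mul_le_mul_of_nonneg_left (hC' y hy) (norm_nonneg _)
    · simp [hgK y hy]
  · obtain ⟨C, hC⟩ := hbound x₀
    refine continuousAt_of_dominated (bound := fun y => ‖g y‖ * C) (Eventually.of_forall hmeas) ?_
      (hg.norm.mul_const C) (Eventually.of_forall fun y => ?_)
    · filter_upwards [Metric.closedBall_mem_nhds x₀ one_pos] with x hx
      exact Eventually.of_forall fun y => hC x hx y
    · have h1 : Continuous fun x => (fderiv ℝ b (x, y)).comp (.inl ℝ (Rd d) (Rd d)) :=
        hb'.comp (continuous_id.prodMk continuous_const)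
      exact (h1.const_smul (g y)).continuousAt

theorem contDiff_integral_mul {d : ℕ} {g : Rd d → ℝ} (hg : Integrable g) {K : Set (Rd d)}
    (hK : IsCompact K) (hgK : ∀ y, y ∉ K → g y = 0) {b : Rd d × Rd d → ℝ} (hb : ContDiff ℝ 1 b) :
    ContDiff ℝ 1 fun x => ∫ y, g y * b (x, y) := by
  obtain ⟨h1, -, h3⟩ := hasFDerivAt_integral_mul hg hK hgK hb
  exact contDiff_one_iff_hasFDerivAt.2 ⟨_, h3, h1⟩

theorem fderiv_integral_mul {d : ℕ} {g : Rd d → ℝ} (hg : Integrable g) {K : Set (Rd d)}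
    (hK : IsCompact K) (hgK : ∀ y, y ∉ K → g y = 0) {b : Rd d × Rd d → ℝ} (hb : ContDiff ℝ 1 b)
    (x v : Rd d) :
    fderiv ℝ (fun x => ∫ y, g y * b (x, y)) x v
      = ∫ y, g y * fderiv ℝ (fun z => b (z, y)) x v := by
  obtain ⟨h1, h2, -⟩ := hasFDerivAt_integral_mul hg hK hgK hb
  rw [(h1 x).fderiv, ContinuousLinearMap.integral_apply (h2 x)]
  refine integral_congr_ae (Eventually.of_forall fun y => ?_)
  simp only [(hasFDerivAt_comp_fst hb x y).fderiv]
  rfl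

end ParametricIntegral

/-! ### Weak gradients: constancy and the Leibniz rule. -/

section WeakGradient

/-- The derivative of a mollification at `x` pairs `r` with the derivative of a reflected,
translated bump, hence is zero. The mollifications are therefore constant, and they converge to `r`
almost everywhere. -/
theorem ae_eq_const_of_weakGradient_eq_zero {d : ℕ} {r : Rd d → ℝ} (hr : LocallyIntegrable r)
    (h : ∀ φ : Rd d → ℝ, ContDiff ℝ 1 φ → HasCompactSupport φ → ∀ v : Rd d,
      ∫ x, r x * fderiv ℝ φ x v = 0) : ∃ c : ℝ, r =ᵐ[volume] fun _ => c := by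
  let L := ContinuousLinearMap.lsmul ℝ ℝ (E := ℝ)
  let φ : ℕ → ContDiffBump (0 : Rd d) := fun n =>
    { rIn := 1 / ((n : ℝ) + 1), rOut := 2 * (1 / ((n : ℝ) + 1)), rIn_pos := by positivity
      rIn_lt_rOut := by
        have : 0 < 1 / ((n : ℝ) + 1) := by positivity
        linarith }
  -- Almost everywhere convergence requires a bounded ratio of outer to inner radius; here it is `K
  -- = 2`.
  have hlim := ContDiffBump.ae_convolution_tendsto_right_of_locallyIntegrable (μ := volume)
    (φ := φ) (l := atTop) (K := 2) (g := r)
    (by simpa [φ] using (tendsto_one_div_add_atTop_nhds_zero_nat (𝕜 := ℝ)).const_mul 2)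
    (Eventually.of_forall fun n => le_rfl) hr
  have hconst : ∀ n x y, (convolution ((φ n).normed volume) r L volume) x
      = (convolution ((φ n).normed volume) r L volume) y := by
    intro n
    have hs : HasCompactSupport ((φ n).normed volume) := (φ n).hasCompactSupport_normed
    have hc : ContDiff ℝ 1 ((φ n).normed volume) := (φ n).contDiff_normed
    have hd := hs.hasFDerivAt_convolution_right L.flip hr hc
    rw [convolution_flip] at hd
    refine is_const_of_fderiv_eq_zero (𝕜 := ℝ) (fun x => (hd x).differentiableAt) fun x => ?_
    rw [(hd x).fderiv]
    ext v
    rw [convolution_precompR_apply _ hr (hs.fderiv ℝ) (hc.continuous_fderiv one_ne_zero)]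
    have h1 := h (fun y => (φ n).normed volume (x - y)) (hc.comp (contDiff_const.sub contDiff_id))
      (hs.comp_homeomorph (Homeomorph.subLeft x)) v
    have h2 : ∀ y, fderiv ℝ (fun y => (φ n).normed volume (x - y)) y v
        = -fderiv ℝ ((φ n).normed volume) (x - y) v := by
      intro y
      have h3 := ((hc.differentiable one_ne_zero) (x - y)).hasFDerivAt.comp y
        ((hasFDerivAt_id y).const_sub x)
      have h4 := congrArg (fun D => D v) h3.fderiv
      exact h4.trans (by simp)
    simp only [h2, mul_neg, integral_neg, neg_eq_zero] at h1
    simp only [convolution_def, _root_.zero_apply]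
    rw [← h1]
    refine integral_congr_ae (Eventually.of_forall fun y => ?_)
    simp [L, mul_comm]
  obtain ⟨x₀, hx₀⟩ := hlim.exists
  refine ⟨r x₀, ?_⟩
  filter_upwards [hlim] with x hx
  refine tendsto_nhds_unique hx (hx₀.congr fun n => hconst n x₀ x)

variable {d : ℕ} {r : Rd d → ℝ} {μ : Measure (Rd d)} {G : Rd d → Rd d}

/-- The Leibniz rule for a distributional gradient, a smooth function and a cutoff. -/
theorem HasDistribGradient.integral_mul_fderiv (hG : HasDistribGradient r μ G) {f χ : Rd d → ℝ}
    (hf : ContDiff ℝ 1 f) (hχ : ContDiff ℝ 1 χ) (hχs : HasCompactSupport χ) (v : Rd d) :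
    ∫ x, r x * (χ x * fderiv ℝ f x v)
      = -∫ x, χ x * f x * inner ℝ (G x) v ∂μ - ∫ x, r x * (f x * fderiv ℝ χ x v) := by
  have h1 := hG.integral_eq (fun x => χ x * f x) (hχ.mul hf) hχs.mul_right v
  have h2 : ∀ x, fderiv ℝ (fun x => χ x * f x) x v
      = χ x * fderiv ℝ f x v + f x * fderiv ℝ χ x v := by
    intro x
    rw [fderiv_fun_mul (hχ.differentiable one_ne_zero x) (hf.differentiable one_ne_zero x)]
    simp
  have hI1 : Integrable fun x => r x * (χ x * fderiv ℝ f x v) :=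
    hG.locallyIntegrable.integrable_smul_right_of_hasCompactSupport
      (g := fun x => χ x * fderiv ℝ f x v)
      (hχ.continuous.mul ((hf.continuous_fderiv one_ne_zero).clm_apply continuous_const))
      hχs.mul_right
  have hI2 : Integrable fun x => r x * (f x * fderiv ℝ χ x v) :=
    hG.locallyIntegrable.integrable_smul_right_of_hasCompactSupport
      (g := fun x => f x * fderiv ℝ χ x v)
      (hf.continuous.mul ((hχ.continuous_fderiv one_ne_zero).clm_apply continuous_const))
      (hχs.fderiv_apply ℝ v).mul_left
  simp only [h2, mul_add] at h1
  rw [integral_add hI1 hI2] at h1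
  linarith

end WeakGradient

/-! ### Cutoff functions. -/

section Cutoff

/-- Smooth cutoff functions that exhaust the space and whose gradients tend to zero uniformly. -/
theorem exists_cutoff (d : ℕ) : ∃ (χ : ℕ → Rd d → ℝ) (C : ℕ → ℝ),
    (∀ n, ContDiff ℝ 1 (χ n)) ∧ (∀ n, HasCompactSupport (χ n)) ∧ (∀ n x, |χ n x| ≤ 1) ∧
    (∀ x, Tendsto (fun n => χ n x) atTop (𝓝 1)) ∧ (∀ n x, ‖fderiv ℝ (χ n) x‖ ≤ C n) ∧
    Tendsto C atTop (𝓝 0) := by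
  let f : ContDiffBump (0 : Rd d) := ⟨1, 2, one_pos, one_lt_two⟩
  have hf : ContDiff ℝ 1 f := f.contDiff
  obtain ⟨C, hC⟩ := (f.hasCompactSupport.fderiv ℝ).exists_bound_of_continuous
    (hf.continuous_fderiv one_ne_zero)
  have hpos : ∀ n : ℕ, (0 : ℝ) < 1 / ((n : ℝ) + 1) := fun n => by positivity
  -- Dilating one fixed bump by `n + 1` divides its gradient by `n + 1`.
  refine ⟨fun n x => f ((1 / ((n : ℝ) + 1)) • x), fun n => (1 / ((n : ℝ) + 1)) * C,
    fun n => hf.comp (contDiff_const_smul _), fun n => ?_, fun n x => ?_, fun x => ?_,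
    fun n x => ?_, ?_⟩
  · exact f.hasCompactSupport.comp_smul (hpos n).ne'
  · rw [abs_of_nonneg f.nonneg]; exact f.le_one
  · refine tendsto_const_nhds.congr' ?_
    have h1 : Tendsto (fun n : ℕ => (1 / ((n : ℝ) + 1)) • x) atTop (𝓝 0) := by
      simpa using (tendsto_one_div_add_atTop_nhds_zero_nat (𝕜 := ℝ)).smul_const x
    filter_upwards [h1 (Metric.closedBall_mem_nhds 0 one_pos)] with n hn
    exact (f.one_of_mem_closedBall hn).symm
  · rw [fderiv_comp_smul, norm_smul, Real.norm_eq_abs, abs_of_pos (hpos n)]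
    exact mul_le_mul_of_nonneg_left (hC _) (hpos n).le
  · simpa using (tendsto_one_div_add_atTop_nhds_zero_nat (𝕜 := ℝ)).mul_const C

end Cutoff

/-! ### Partial derivatives and the Stein kernel. -/

section PartialDerivatives

variable {d : ℕ}

/-- The partial derivative `∂ᵢ f`. -/
noncomputable def partialDeriv (i : Fin d) (f : Rd d → ℝ) (x : Rd d) : ℝ :=
  fderiv ℝ f x (EuclideanSpace.single i 1)

theorem gradient_apply_eq_partialDeriv (f : Rd d → ℝ) (x : Rd d) (i : Fin d) :
    gradient f x i = partialDeriv i f x := by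
  have h1 : inner ℝ (gradient f x) (EuclideanSpace.single i (1 : ℝ)) = partialDeriv i f x := by
    rw [gradient, InnerProductSpace.toDual_symm_apply, partialDeriv]
  rw [← h1, EuclideanSpace.inner_single_right]
  simp

theorem continuous_partialDeriv (i : Fin d) {f : Rd d → ℝ} (hf : ContDiff ℝ 1 f) :
    Continuous (partialDeriv i f) :=
  (hf.continuous_fderiv one_ne_zero).clm_apply continuous_const

theorem partialDeriv_mul (i : Fin d) {f g : Rd d → ℝ} (hf : ContDiff ℝ 1 f) (hg : ContDiff ℝ 1 g)
    (x : Rd d) : partialDeriv i (fun y => f y * g y) x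
      = partialDeriv i f x * g x + f x * partialDeriv i g x := by
  rw [partialDeriv, fderiv_fun_mul (hf.differentiable one_ne_zero x)
    (hg.differentiable one_ne_zero x)]
  simp [partialDeriv]
  ring

theorem score_apply (i : Fin d) {ρ : Rd d → ℝ} (hρ : ContDiff ℝ 1 ρ) (hpos : ∀ x, 0 < ρ x)
    (x : Rd d) : score ρ x i = partialDeriv i ρ x / ρ x := by
  rw [score, gradient_apply_eq_partialDeriv, partialDeriv,
    fderiv.log (hρ.differentiable one_ne_zero x) (hpos x).ne', partialDeriv]
  simp [div_eq_inv_mul]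

variable {k : Rd d → Rd d → ℝ}

theorem contDiff_kernel_right (hk : ContDiff ℝ 2 fun z : Rd d × Rd d => k z.1 z.2) (x : Rd d) :
    ContDiff ℝ 2 (k x) :=
  hk.comp (contDiff_const.prodMk contDiff_id)

/-- Taking the partial derivative as the joint derivative along `(0, eᵢ)` gives regularity in both
variables at once, at the cost of one of the two derivatives of `k`. -/
theorem contDiff_partialDeriv_kernel (hk : ContDiff ℝ 2 fun z : Rd d × Rd d => k z.1 z.2)
    (i : Fin d) : ContDiff ℝ 1 fun z : Rd d × Rd d => partialDeriv i (k z.1) z.2 := by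
  have h1 : (fun z : Rd d × Rd d => partialDeriv i (k z.1) z.2)
      = fun z => fderiv ℝ (fun z : Rd d × Rd d => k z.1 z.2) z (0, EuclideanSpace.single i 1) := by
    ext z
    have h2 := ((hk.differentiable two_ne_zero) (z.1, z.2)).hasFDerivAt.comp z.2
      (hasFDerivAt_prodMk_right z.1 z.2)
    exact congrArg (fun D => D (EuclideanSpace.single i 1)) h2.fderiv
  rw [h1]
  exact (hk.fderiv_right (m := 1) (by norm_num)).clm_apply contDiff_const

/-- Multiplied by `ρ(x) ρ(y)`, the Stein kernel is `∑ᵢ ∂_{xᵢ} ∂_{yᵢ} (ρ(x) ρ(y) k(x, y))`. -/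
theorem mul_mul_steinKernel {ρ : Rd d → ℝ} (hρ : ContDiff ℝ 1 ρ) (hpos : ∀ x, 0 < ρ x)
    (x y : Rd d) :
    ρ x * ρ y * steinKernel k ρ x y = ∑ i, (partialDeriv i ρ x *
        (partialDeriv i ρ y * k x y + ρ y * partialDeriv i (k x) y)
      + ρ x * (partialDeriv i ρ y * partialDeriv i (fun z => k z y) x
        + ρ y * partialDeriv i (fun z => partialDeriv i (k z) y) x)) := by
  have hx := (hpos x).ne'
  have hy := (hpos y).ne'
  have hgs : ∀ z i, gradSnd k z y i = partialDeriv i (k z) y := fun z i =>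
    gradient_apply_eq_partialDeriv _ _ _
  have hgf : ∀ i, gradFst k x y i = partialDeriv i (fun z => k z y) x := fun i =>
    gradient_apply_eq_partialDeriv _ _ _
  have hdg : divGrad k x y = ∑ i, partialDeriv i (fun z => partialDeriv i (k z) y) x := by
    simp only [divGrad, hgs]; rfl
  simp only [steinKernel, hdg, PiLp.inner_apply, PiLp.smul_apply, smul_eq_mul, hgs, hgf,
    score_apply _ hρ hpos, RCLike.inner_apply, conj_trivial]
  rw [← Finset.sum_add_distrib, ← Finset.sum_add_distrib, ← Finset.sum_add_distrib,
    Finset.mul_sum]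
  refine Finset.sum_congr rfl fun i _ => ?_
  field_simp
  ring

theorem continuous_partialDeriv_kernel_left
    (hk : ContDiff ℝ 1 fun z : Rd d × Rd d => k z.1 z.2) (i : Fin d) :
    Continuous fun z : Rd d × Rd d => partialDeriv i (fun x => k x z.2) z.1 := by
  have h1 : (fun z : Rd d × Rd d => partialDeriv i (fun x => k x z.2) z.1)
      = fun z => fderiv ℝ (fun z : Rd d × Rd d => k z.1 z.2) z (EuclideanSpace.single i 1, 0) := by
    ext z
    exact congrArg (fun D => D (EuclideanSpace.single i 1)) (hasFDerivAt_comp_fst hk z.1 z.2).fderiv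
  rw [h1]
  exact (hk.continuous_fderiv one_ne_zero).clm_apply continuous_const

end PartialDerivatives

/-! ### The localized Stein identity. -/

section SteinIdentity

variable {d : ℕ} {r : Rd d → ℝ} {μ : Measure (Rd d)} {G : Rd d → Rd d} {k : Rd d → Rd d → ℝ}
  {ρ χ : Rd d → ℝ}

theorem integrable_mul_cutoff_mul (hr : LocallyIntegrable r) (hχ : Continuous χ)
    (hχs : HasCompactSupport χ) {g : Rd d → ℝ} (hg : Continuous g) :
    Integrable fun y => r y * (χ y * g y) :=
  hr.integrable_smul_right_of_hasCompactSupport (g := fun y => χ y * g y) (hχ.mul hg)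
    hχs.mul_right

/-- The localized Stein witness function
`Fᵢ(x) = ∫ r(y) χ(y) ∂_{yᵢ} (ρ(y) k(x, y)) dy`. -/
noncomputable def steinWitness (k : Rd d → Rd d → ℝ) (ρ r χ : Rd d → ℝ) (i : Fin d)
    (x : Rd d) : ℝ :=
  ∫ y, r y * (χ y * partialDeriv i (fun z => ρ z * k x z) y)

/-- The product rule isolates the dependence on `x` in `C^1` kernels, integrated against fixed
integrable functions of `y` supported in `tsupport χ`; this is the form needed to differentiate
under the integral. -/
theorem steinWitness_eq (hr : LocallyIntegrable r) (hχ : ContDiff ℝ 1 χ)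
    (hχs : HasCompactSupport χ) (hρ : ContDiff ℝ 1 ρ)
    (hk : ContDiff ℝ 2 fun z : Rd d × Rd d => k z.1 z.2) (i : Fin d) (x : Rd d) :
    steinWitness k ρ r χ i x = (∫ y, (r y * (χ y * partialDeriv i ρ y)) * k x y)
      + ∫ y, (r y * (χ y * ρ y)) * partialDeriv i (k x) y := by
  have hkx : ContDiff ℝ 1 (k x) := (contDiff_kernel_right hk x).of_le one_le_two
  rw [← integral_add]
  · refine integral_congr_ae (Eventually.of_forall fun y => ?_)
    simp only [partialDeriv_mul i hρ hkx]
    ring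
  · refine (integrable_mul_cutoff_mul hr hχ.continuous hχs
      ((continuous_partialDeriv i hρ).mul hkx.continuous)).congr (Eventually.of_forall fun y => ?_)
    simp only [Pi.mul_apply]; ring
  · refine (integrable_mul_cutoff_mul hr hχ.continuous hχs
      (hρ.continuous.mul (continuous_partialDeriv i hkx))).congr (Eventually.of_forall fun y => ?_)
    simp only [Pi.mul_apply]; ring

theorem steinWitness_regular (hr : LocallyIntegrable r) (hχ : ContDiff ℝ 1 χ)
    (hχs : HasCompactSupport χ) (hρ : ContDiff ℝ 1 ρ)
    (hk : ContDiff ℝ 2 fun z : Rd d × Rd d => k z.1 z.2) (i : Fin d) :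
    ContDiff ℝ 1 (steinWitness k ρ r χ i) ∧ ∀ x, partialDeriv i (steinWitness k ρ r χ i) x
      = ∫ y, r y * (χ y * (partialDeriv i ρ y * partialDeriv i (fun z => k z y) x
        + ρ y * partialDeriv i (fun z => partialDeriv i (k z) y) x)) := by
  have hk1 : ContDiff ℝ 1 fun z : Rd d × Rd d => k z.1 z.2 := hk.of_le one_le_two
  have hk2 := contDiff_partialDeriv_kernel hk i
  have hi1 := integrable_mul_cutoff_mul hr hχ.continuous hχs (continuous_partialDeriv i hρ)
  have hi2 := integrable_mul_cutoff_mul hr hχ.continuous hχs hρ.continuous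
  have h01 : ∀ y, y ∉ tsupport χ → r y * (χ y * partialDeriv i ρ y) = 0 := fun y hy => by
    simp [image_eq_zero_of_notMem_tsupport hy]
  have h02 : ∀ y, y ∉ tsupport χ → r y * (χ y * ρ y) = 0 := fun y hy => by
    simp [image_eq_zero_of_notMem_tsupport hy]
  have heq : steinWitness k ρ r χ i = fun x => (∫ y, (r y * (χ y * partialDeriv i ρ y)) * k x y)
      + ∫ y, (r y * (χ y * ρ y)) * partialDeriv i (k x) y :=
    funext fun x => steinWitness_eq hr hχ hχs hρ hk i x
  have hc1 := contDiff_integral_mul hi1 hχs h01 hk1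
  have hc2 := contDiff_integral_mul hi2 hχs h02 hk2
  have hxc : ∀ x : Rd d, Continuous fun y : Rd d => (x, y) := fun x => by fun_prop
  refine ⟨heq ▸ hc1.add hc2, fun x => ?_⟩
  rw [heq, partialDeriv, fderiv_fun_add (hc1.differentiable one_ne_zero x)
    (hc2.differentiable one_ne_zero x), _root_.add_apply,
    fderiv_integral_mul hi1 hχs h01 hk1, fderiv_integral_mul hi2 hχs h02 hk2, ← integral_add]
  · refine integral_congr_ae (Eventually.of_forall fun y => ?_)
    simp only [partialDeriv]
    ring
  · refine (integrable_mul_cutoff_mul hr hχ.continuous hχs ((continuous_partialDeriv i hρ).mul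
      ((continuous_partialDeriv_kernel_left hk1 i).comp (hxc x)))).congr
      (Eventually.of_forall fun y => ?_)
    simp only [Pi.mul_apply, Function.comp, partialDeriv]; ring
  · refine (integrable_mul_cutoff_mul hr hχ.continuous hχs (hρ.continuous.mul
      ((continuous_partialDeriv_kernel_left (k := fun x y => partialDeriv i (k x) y) hk2 i).comp
        (hxc x)))).congr (Eventually.of_forall fun y => ?_)
    simp only [Pi.mul_apply, Function.comp, partialDeriv]; ring

variable {H : Type*} [NormedAddCommGroup H] [InnerProductSpace ℝ H] {Φ : Rd d → H}

/-- The kernel mean embedding of the vector measure `χ ρ Gᵢ dμ`. -/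
noncomputable def gradEmbedding (Φ : Rd d → H) (μ : Measure (Rd d)) (G : Rd d → Rd d)
    (ρ χ : Rd d → ℝ) (i : Fin d) : H :=
  ∫ x, (χ x * (ρ x * G x i)) • Φ x ∂μ

/-- The kernel mean embedding of the boundary term `r ρ ∂ᵢ χ dx`. -/
noncomputable def boundaryEmbedding (Φ : Rd d → H) (r ρ χ : Rd d → ℝ) (i : Fin d) : H :=
  ∫ x, (r x * (ρ x * partialDeriv i χ x)) • Φ x

theorem locallyIntegrable_coord (hG : LocallyIntegrable G μ) (i : Fin d) :
    LocallyIntegrable (fun x => G x i) μ := fun x => by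
  obtain ⟨s, hs, hi⟩ := hG x
  exact ⟨s, hs, (EuclideanSpace.proj (𝕜 := ℝ) i).integrable_comp hi⟩

theorem integrable_gradEmbedding (hG : LocallyIntegrable G μ) (hρ : Continuous ρ)
    (hχ : Continuous χ) (hχs : HasCompactSupport χ) (hΦ : Continuous Φ) (i : Fin d) :
    Integrable (fun x => (χ x * (ρ x * G x i)) • Φ x) μ := by
  have h1 := (locallyIntegrable_coord hG i).integrable_smul_right_of_hasCompactSupport
    (g := fun x => χ x • (ρ x • Φ x)) (hχ.smul (hρ.smul hΦ)) hχs.smul_right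
  refine h1.congr (Eventually.of_forall fun x => ?_)
  simp only [smul_smul]
  congr 1
  ring

theorem integrable_boundaryEmbedding (hr : LocallyIntegrable r) (hρ : Continuous ρ)
    (hχ : ContDiff ℝ 1 χ) (hχs : HasCompactSupport χ) (hΦ : Continuous Φ) (i : Fin d) :
    Integrable (fun x => (r x * (ρ x * partialDeriv i χ x)) • Φ x) := by
  have h1 := hr.integrable_smul_right_of_hasCompactSupport
    (g := fun x => partialDeriv i χ x • (ρ x • Φ x))
    ((continuous_partialDeriv i hχ).smul (hρ.smul hΦ))
    (HasCompactSupport.smul_right (hχs.fderiv_apply ℝ (EuclideanSpace.single i 1)))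
  refine h1.congr (Eventually.of_forall fun x => ?_)
  simp only [smul_smul]
  congr 1
  ring

/-- The Leibniz rule is applied to the scalar function `ρ ⟨c, Φ⟩`, after which `c` is pulled out of
the Bochner integrals. `Φ` is only assumed continuous, so smoothness of `⟨c, Φ⟩` is a separate
hypothesis. -/
theorem integral_mul_inner_embedding [CompleteSpace H] (hG : HasDistribGradient r μ G)
    (hρ : ContDiff ℝ 1 ρ)
    (hχ : ContDiff ℝ 1 χ) (hχs : HasCompactSupport χ) (hΦ : Continuous Φ) (i : Fin d) (c : H)
    (hc : ContDiff ℝ 1 fun x => inner ℝ c (Φ x)) :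
    ∫ y, r y * (χ y * partialDeriv i (fun z => ρ z * inner ℝ c (Φ z)) y)
      = inner ℝ c (-gradEmbedding Φ μ G ρ χ i - boundaryEmbedding Φ r ρ χ i) := by
  have h1 := hG.integral_mul_fderiv (hρ.mul hc) hχ hχs (EuclideanSpace.single i 1)
  simp only [partialDeriv]
  rw [h1, inner_sub_right, inner_neg_right, gradEmbedding, boundaryEmbedding,
    ← integral_inner (integrable_gradEmbedding hG.locallyIntegrable_grad hρ.continuous
      hχ.continuous hχs hΦ i),
    ← integral_inner (integrable_boundaryEmbedding hG.locallyIntegrable hρ.continuous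
      hχ hχs hΦ i)]
  refine congrArg₂ (· - ·) (congrArg Neg.neg ?_) ?_
  · refine integral_congr_ae (Eventually.of_forall fun x => ?_)
    simp only [inner_smul_right, EuclideanSpace.inner_single_right, conj_trivial]
    ring
  · refine integral_congr_ae (Eventually.of_forall fun x => ?_)
    simp only [inner_smul_right, partialDeriv]
    ring

/-- The localized Stein energy is the squared norm of the embedded weak gradient. -/
theorem integral_steinWitness_eq_norm_sq [CompleteSpace H] (hG : HasDistribGradient r μ G)
    (hρ : ContDiff ℝ 1 ρ)
    (hχ : ContDiff ℝ 1 χ) (hχs : HasCompactSupport χ)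
    (hk : ContDiff ℝ 2 fun z : Rd d × Rd d => k z.1 z.2)
    (hΦ : ∀ x y, inner ℝ (Φ x) (Φ y) = k x y) (i : Fin d) :
    ∫ x, r x * (χ x * partialDeriv i (fun z => ρ z * steinWitness k ρ r χ i z) x)
      = ‖gradEmbedding Φ μ G ρ χ i + boundaryEmbedding Φ r ρ χ i‖ ^ 2 := by
  have hΦc := continuous_featureMap hΦ hk.continuous
  -- Integration by parts is used twice: with `c = Φ x` it identifies the witness as `⟨T, Φ x⟩`, and
  -- with `c = T` it gives `⟨T, T⟩`. Smoothness in the second use comes from `steinWitness_regular`.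
  set T := -gradEmbedding Φ μ G ρ χ i - boundaryEmbedding Φ r ρ χ i with hT
  have h1 : ∀ x, steinWitness k ρ r χ i x = inner ℝ T (Φ x) := by
    intro x
    rw [real_inner_comm, ← integral_mul_inner_embedding hG hρ hχ hχs hΦc i (Φ x)
      (by simpa only [hΦ] using (contDiff_kernel_right hk x).of_le one_le_two)]
    simp only [hΦ]
    rfl
  have h2 : steinWitness k ρ r χ i = fun x => inner ℝ T (Φ x) := funext h1
  have h3 := (steinWitness_regular hG.locallyIntegrable hχ hχs hρ hk i).1
  rw [h2] at h3 ⊢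
  rw [integral_mul_inner_embedding hG hρ hχ hχs hΦc i T h3, ← hT, real_inner_self_eq_norm_sq,
    hT, ← neg_add', norm_neg]

end SteinIdentity

/-! ### Integration against a density. -/

section Density

variable {d : ℕ} {q : Rd d → ℝ}

theorem integral_densityMeasure (hq : IsProbDensity q) (f : Rd d → ℝ) :
    ∫ x, f x ∂densityMeasure q = ∫ x, q x * f x := by
  rw [densityMeasure, integral_withDensity_eq_integral_toReal_smul hq.measurable.ennreal_ofReal
    (Eventually.of_forall fun _ => ENNReal.ofReal_lt_top)]
  simp only [ENNReal.toReal_ofReal (hq.nonneg _), smul_eq_mul]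

theorem integrable_densityMeasure_iff (hq : IsProbDensity q) {f : Rd d → ℝ} :
    Integrable f (densityMeasure q) ↔ Integrable fun x => q x * f x := by
  rw [densityMeasure, integrable_withDensity_iff_integrable_smul' hq.measurable.ennreal_ofReal
    (Eventually.of_forall fun _ => ENNReal.ofReal_lt_top)]
  simp only [ENNReal.toReal_ofReal (hq.nonneg _), smul_eq_mul]

/-- Proportional probability densities are equal. -/
theorem ae_eq_of_div_ae_eq_const {p : Rd d → ℝ} (hp : IsProbDensity p) (hp_pos : ∀ x, 0 < p x)
    (hq : IsProbDensity q) {c : ℝ} (h : (fun x => q x / p x) =ᵐ[volume] fun _ => c) :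
    q =ᵐ[volume] p := by
  have h1 : ∀ᵐ x, q x = c * p x := by
    filter_upwards [h] with x hx
    rw [← hx, div_mul_cancel₀ _ (hp_pos x).ne']
  have h2 : ENNReal.ofReal c = 1 := by
    have h3 : ∫⁻ x, ENNReal.ofReal (q x) = ENNReal.ofReal c * ∫⁻ x, ENNReal.ofReal (p x) := by
      rw [← lintegral_const_mul _ hp.measurable.ennreal_ofReal]
      refine lintegral_congr_ae ?_
      filter_upwards [h1] with x hx
      rw [hx, ENNReal.ofReal_mul' (hp_pos x).le]
    rw [hq.lintegral_eq_one, hp.lintegral_eq_one, mul_one] at h3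
    exact h3.symm
  have h3 : c = 1 := ENNReal.ofReal_eq_one.1 h2
  filter_upwards [h1] with x hx
  rw [hx, h3, one_mul]

end Density

/-! ### The discrepancy as a kernel energy. -/

section SteinEnergy

variable {d : ℕ} {p q : Rd d → ℝ} {μ : Measure (Rd d)} {G : Rd d → Rd d} {k : Rd d → Rd d → ℝ}
  {ρ χ : Rd d → ℝ}

/-- Integrating out `y` produces the witness `Fᵢ` and its derivative `∂ᵢ Fᵢ`; the product rule in
`x` reassembles them into `∂ᵢ (ρ Fᵢ)`. -/
theorem integral_cutoff_gfKernel_right (hr : LocallyIntegrable fun x => q x / p x)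
    (hρ : ContDiff ℝ 1 ρ) (hρ_pos : ∀ x, 0 < ρ x) (hχ : ContDiff ℝ 1 χ) (hχs : HasCompactSupport χ)
    (hk : ContDiff ℝ 2 fun z : Rd d × Rd d => k z.1 z.2) (x : Rd d) :
    ∫ y, q y * (χ x * χ y * gfKernel k ρ p x y)
      = χ x / p x * ∑ i, partialDeriv i
          (fun z => ρ z * steinWitness k ρ (fun x => q x / p x) χ i z) x := by
  have hk1 : ContDiff ℝ 1 fun z : Rd d × Rd d => k z.1 z.2 := hk.of_le one_le_two
  have hxc : Continuous fun y : Rd d => (x, y) := by fun_prop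
  have hkx : ContDiff ℝ 1 (k x) := (contDiff_kernel_right hk x).of_le one_le_two
  have hA : ∀ i : Fin d, Continuous (partialDeriv i (fun z => ρ z * k x z)) := fun i =>
    continuous_partialDeriv i (hρ.mul hkx)
  have hB : ∀ i : Fin d, Continuous fun y => partialDeriv i ρ y * partialDeriv i (fun z => k z y) x
      + ρ y * partialDeriv i (fun z => partialDeriv i (k z) y) x := fun i =>
    ((continuous_partialDeriv i hρ).mul
      ((continuous_partialDeriv_kernel_left hk1 i).comp hxc)).add (hρ.continuous.mul
      ((continuous_partialDeriv_kernel_left (k := fun x y => partialDeriv i (k x) y)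
        (contDiff_partialDeriv_kernel hk i) i).comp hxc))
  have hIA := fun i => (integrable_mul_cutoff_mul hr hχ.continuous hχs (hA i)).const_mul
    (partialDeriv i ρ x)
  have hIB := fun i => (integrable_mul_cutoff_mul hr hχ.continuous hχs (hB i)).const_mul (ρ x)
  have hpt : ∀ y, q y * (χ x * χ y * gfKernel k ρ p x y) = χ x / p x * ∑ i,
      (partialDeriv i ρ x * (q y / p y * (χ y * partialDeriv i (fun z => ρ z * k x z) y))
      + ρ x * (q y / p y * (χ y * (partialDeriv i ρ y * partialDeriv i (fun z => k z y) x
        + ρ y * partialDeriv i (fun z => partialDeriv i (k z) y) x)))) := by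
    intro y
    have h1 : q y * (χ x * χ y * gfKernel k ρ p x y)
        = χ x / p x * (q y / p y * χ y * (ρ x * ρ y * steinKernel k ρ x y)) := by
      simp only [gfKernel, weight]
      ring
    rw [h1, mul_mul_steinKernel hρ hρ_pos, Finset.mul_sum]
    congr 1
    refine Finset.sum_congr rfl fun i _ => ?_
    rw [partialDeriv_mul i hρ hkx]
    ring
  simp only [hpt]
  rw [integral_const_mul, integral_finsetSum]
  swap
  · exact fun i _ => (hIA i).add (hIB i)
  congr 1
  refine Finset.sum_congr rfl fun i _ => ?_
  obtain ⟨hF, hF'⟩ := steinWitness_regular hr hχ hχs hρ hk i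
  rw [integral_add (hIA i) (hIB i), integral_const_mul, integral_const_mul,
    partialDeriv_mul i hρ hF, hF']
  rfl

theorem integrable_cutoff_gfKernel {Q : Measure (Rd d)}
    (hS : Integrable (fun z : Rd d × Rd d => gfKernel k ρ p z.1 z.2) (Q.prod Q))
    (hχ : Continuous χ) (hχ1 : ∀ x, |χ x| ≤ 1) :
    Integrable (fun z : Rd d × Rd d => χ z.1 * χ z.2 * gfKernel k ρ p z.1 z.2) (Q.prod Q) := by
  refine hS.mono ?_ (Eventually.of_forall fun z => ?_)
  · have h1 : Continuous fun z : Rd d × Rd d => χ z.1 * χ z.2 := by fun_prop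
    exact h1.aestronglyMeasurable.mul hS.aestronglyMeasurable
  · rw [norm_mul, norm_mul]
    exact mul_le_of_le_one_left (norm_nonneg _)
      (mul_le_one₀ (hχ1 _) (norm_nonneg _) (hχ1 _))

variable {H : Type*} [NormedAddCommGroup H] [InnerProductSpace ℝ H] [CompleteSpace H]
  {Φ : Rd d → H}

theorem integral_cutoff_gfKernel (hq : IsProbDensity q)
    (hG : HasDistribGradient (fun x => q x / p x) μ G)
    (hρ : ContDiff ℝ 1 ρ) (hρ_pos : ∀ x, 0 < ρ x) (hχ : ContDiff ℝ 1 χ) (hχs : HasCompactSupport χ)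
    (hχ1 : ∀ x, |χ x| ≤ 1) (hk : ContDiff ℝ 2 fun z : Rd d × Rd d => k z.1 z.2)
    (hΦ : ∀ x y, inner ℝ (Φ x) (Φ y) = k x y)
    (hS : Integrable (fun z : Rd d × Rd d => gfKernel k ρ p z.1 z.2)
      ((densityMeasure q).prod (densityMeasure q))) :
    ∫ z : Rd d × Rd d, χ z.1 * χ z.2 * gfKernel k ρ p z.1 z.2
        ∂((densityMeasure q).prod (densityMeasure q))
      = ∑ i, ‖gradEmbedding Φ μ G ρ χ i
          + boundaryEmbedding Φ (fun x => q x / p x) ρ χ i‖ ^ 2 := by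
  have := isProbabilityMeasure_densityMeasure hq
  have hr := hG.locallyIntegrable
  rw [integral_prod _ (integrable_cutoff_gfKernel hS hχ.continuous hχ1)]
  simp only [integral_densityMeasure hq,
    integral_cutoff_gfKernel_right hr hρ hρ_pos hχ hχs hk]
  simp only [← integral_steinWitness_eq_norm_sq hG hρ hχ hχs hk hΦ]
  rw [← integral_finsetSum]
  · refine integral_congr_ae (Eventually.of_forall fun x => ?_)
    simp only [Finset.mul_sum]
    refine Finset.sum_congr rfl fun i _ => ?_
    ring
  · exact fun i _ => integrable_mul_cutoff_mul hr hχ.continuous hχs (continuous_partialDeriv i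
      (hρ.mul (steinWitness_regular hr hχ hχs hρ hk i).1))

theorem norm_sq_integral_smul (hΦ : ∀ x y, inner ℝ (Φ x) (Φ y) = k x y) {f : Rd d → ℝ}
    (hf : Integrable (fun x => f x • Φ x) μ) :
    ‖∫ x, f x • Φ x ∂μ‖ ^ 2 = ∫ x, ∫ y, f x * k x y * f y ∂μ ∂μ := by
  rw [← real_inner_self_eq_norm_sq, ← integral_inner hf]
  refine integral_congr_ae (Eventually.of_forall fun x => ?_)
  simp only
  rw [real_inner_comm, ← integral_inner hf]
  refine integral_congr_ae (Eventually.of_forall fun y => ?_)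
  simp only [inner_smul_left, inner_smul_right, hΦ, conj_trivial]
  ring

theorem integrable_coord_energy [SFinite μ] (hk : Continuous fun z : Rd d × Rd d => k z.1 z.2)
    (hρ : Continuous ρ) (hG : LocallyIntegrable G μ)
    (hG_energy : Integrable (fun z : Rd d × Rd d =>
      k z.1 z.2 * ‖ρ z.1 • G z.1‖ * ‖ρ z.2 • G z.2‖) (μ.prod μ)) (i : Fin d) :
    Integrable (fun z : Rd d × Rd d => (ρ z.1 * G z.1 i) * k z.1 z.2 * (ρ z.2 * G z.2 i))
      (μ.prod μ) := by
  have hg : AEStronglyMeasurable (fun x => ρ x * G x i) μ :=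
    hρ.aestronglyMeasurable.mul (locallyIntegrable_coord hG i).aestronglyMeasurable
  refine hG_energy.mono ((hg.comp_fst.mul hk.aestronglyMeasurable).mul hg.comp_snd)
    (Eventually.of_forall fun z => ?_)
  have hc : ∀ x, ‖ρ x * G x i‖ ≤ ‖ρ x • G x‖ := fun x => by
    simpa using PiLp.norm_apply_le (ρ x • G x) i
  calc ‖ρ z.1 * G z.1 i * k z.1 z.2 * (ρ z.2 * G z.2 i)‖
      = ‖k z.1 z.2‖ * ‖ρ z.1 * G z.1 i‖ * ‖ρ z.2 * G z.2 i‖ := by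
        rw [norm_mul, norm_mul _ (k z.1 z.2), mul_comm ‖k z.1 z.2‖]
    _ ≤ ‖k z.1 z.2‖ * ‖ρ z.1 • G z.1‖ * ‖ρ z.2 • G z.2‖ := by
        gcongr
        · exact hc _
        · exact hc _
    _ = ‖k z.1 z.2 * ‖ρ z.1 • G z.1‖ * ‖ρ z.2 • G z.2‖‖ := by
        rw [norm_mul, norm_mul (k z.1 z.2), norm_norm, norm_norm]

/-- The gradient-free kernelized Stein discrepancy is the kernel energy of `ρ ∇(q / p)`. -/
theorem integral_gfKernel_eq [IsLocallyFiniteMeasure μ] (hk : IsPDKernel k)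
    (hk_smooth : ContDiff ℝ 2 fun z : Rd d × Rd d => k z.1 z.2) (hq : IsProbDensity q)
    (hp_pos : ∀ x, 0 < p x) (hρ : ContDiff ℝ 1 ρ) (hρ_pos : ∀ x, 0 < ρ x)
    (hG : HasDistribGradient (fun x => q x / p x) μ G)
    (hG_energy : Integrable (fun z : Rd d × Rd d =>
      k z.1 z.2 * ‖ρ z.1 • G z.1‖ * ‖ρ z.2 • G z.2‖) (μ.prod μ))
    (hS : Integrable (fun z : Rd d × Rd d => gfKernel k ρ p z.1 z.2)
      ((densityMeasure q).prod (densityMeasure q)))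
    (hStein : Integrable (fun x => weight ρ p x * Real.sqrt (k x x)) (densityMeasure q)) :
    ∫ z : Rd d × Rd d, gfKernel k ρ p z.1 z.2 ∂((densityMeasure q).prod (densityMeasure q))
      = ∑ i, ∫ z : Rd d × Rd d, (ρ z.1 * G z.1 i) * k z.1 z.2 * (ρ z.2 * G z.2 i)
          ∂(μ.prod μ) := by
  have := isProbabilityMeasure_densityMeasure hq
  obtain ⟨H, _, _, _, Φ, hΦ⟩ := hk.exists_featureMap
  have hΦc := continuous_featureMap hΦ hk_smooth.continuous
  obtain ⟨χ, C, hχ, hχs, hχ1, hχlim, hχC, hC⟩ := exists_cutoff d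
  have hlimS : Tendsto (fun n => ∫ z : Rd d × Rd d, χ n z.1 * χ n z.2 * gfKernel k ρ p z.1 z.2
      ∂((densityMeasure q).prod (densityMeasure q))) atTop
      (𝓝 (∫ z : Rd d × Rd d, gfKernel k ρ p z.1 z.2
        ∂((densityMeasure q).prod (densityMeasure q)))) := by
    refine tendsto_integral_of_dominated_convergence (fun z => ‖gfKernel k ρ p z.1 z.2‖)
      (fun n => (integrable_cutoff_gfKernel hS (hχ n).continuous (hχ1 n)).aestronglyMeasurable)
      hS.norm (fun n => Eventually.of_forall fun z => ?_) (Eventually.of_forall fun z => ?_)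
    · rw [norm_mul, norm_mul]
      exact mul_le_of_le_one_left (norm_nonneg _)
        (mul_le_one₀ (hχ1 n _) (norm_nonneg _) (hχ1 n _))
    · simpa using ((hχlim z.1).mul (hχlim z.2)).mul_const (gfKernel k ρ p z.1 z.2)
  have hgrad : ∀ i, Tendsto (fun n => ‖gradEmbedding Φ μ G ρ (χ n) i‖ ^ 2) atTop
      (𝓝 (∫ z : Rd d × Rd d, (ρ z.1 * G z.1 i) * k z.1 z.2 * (ρ z.2 * G z.2 i)
        ∂(μ.prod μ))) := by
    intro i
    have hE := integrable_coord_energy hk_smooth.continuous hρ.continuous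
      hG.locallyIntegrable_grad hG_energy i
    have hmono : ∀ n, ∀ z : Rd d × Rd d, ‖χ n z.1 * χ n z.2 *
        ((ρ z.1 * G z.1 i) * k z.1 z.2 * (ρ z.2 * G z.2 i))‖
        ≤ ‖(ρ z.1 * G z.1 i) * k z.1 z.2 * (ρ z.2 * G z.2 i)‖ := fun n z => by
      rw [norm_mul, norm_mul (χ n z.1)]
      exact mul_le_of_le_one_left (norm_nonneg _)
        (mul_le_one₀ (hχ1 n _) (norm_nonneg _) (hχ1 n _))
    have hmeas : ∀ n, AEStronglyMeasurable (fun z : Rd d × Rd d => χ n z.1 * χ n z.2 *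
        ((ρ z.1 * G z.1 i) * k z.1 z.2 * (ρ z.2 * G z.2 i))) (μ.prod μ) := fun n => by
      have hc := (hχ n).continuous
      have h1 : Continuous fun z : Rd d × Rd d => χ n z.1 * χ n z.2 := by fun_prop
      exact h1.aestronglyMeasurable.mul hE.aestronglyMeasurable
    have heq : ∀ n, ‖gradEmbedding Φ μ G ρ (χ n) i‖ ^ 2 = ∫ z : Rd d × Rd d, χ n z.1 * χ n z.2 *
        ((ρ z.1 * G z.1 i) * k z.1 z.2 * (ρ z.2 * G z.2 i)) ∂(μ.prod μ) := by
      intro n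
      rw [gradEmbedding, norm_sq_integral_smul hΦ (integrable_gradEmbedding
        hG.locallyIntegrable_grad hρ.continuous (hχ n).continuous (hχs n) hΦc i),
        integral_prod _ (hE.mono (hmeas n) (Eventually.of_forall (hmono n)))]
      congr 1 with x
      congr 1 with y
      ring
    simp only [heq]
    refine tendsto_integral_of_dominated_convergence _ hmeas hE.norm
      (fun n => Eventually.of_forall (hmono n)) (Eventually.of_forall fun z => ?_)
    simpa using ((hχlim z.1).mul (hχlim z.2)).mul_const
      ((ρ z.1 * G z.1 i) * k z.1 z.2 * (ρ z.2 * G z.2 i))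
  -- Since `‖Φ x‖ = √(k x x)`, the integrand is dominated by `C n` times the integrable function `q
  -- w √(k x x)`.
  have hbdry : ∀ i, Tendsto (fun n => ‖boundaryEmbedding Φ (fun x => q x / p x) ρ (χ n) i‖) atTop
      (𝓝 0) := by
    intro i
    rw [integrable_densityMeasure_iff hq] at hStein
    refine squeeze_zero (fun n => norm_nonneg _) (fun n => ?_)
      (by simpa using hC.mul_const (∫ x, q x * (weight ρ p x * √(k x x))))
    rw [boundaryEmbedding, ← integral_const_mul]
    refine norm_integral_le_of_norm_le (hStein.const_mul (C n)) (Eventually.of_forall fun x => ?_)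
    have h1 : ‖Φ x‖ = √(k x x) := by
      rw [← hΦ, real_inner_self_eq_norm_sq, Real.sqrt_sq (norm_nonneg _)]
    have h2 : |partialDeriv i (χ n) x| ≤ C n := by
      refine ((fderiv ℝ (χ n) x).le_opNorm _).trans ?_
      simpa using hχC n x
    have h3 : 0 ≤ q x / p x := div_nonneg (hq.nonneg x) (hp_pos x).le
    rw [norm_smul, h1, norm_mul, norm_mul, Real.norm_of_nonneg h3,
      Real.norm_of_nonneg (hρ_pos x).le, Real.norm_eq_abs]
    calc q x / p x * (ρ x * |partialDeriv i (χ n) x|) * √(k x x)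
        ≤ q x / p x * (ρ x * C n) * √(k x x) := by
          have := (hρ_pos x).le
          gcongr
      _ = C n * (q x * (weight ρ p x * √(k x x))) := by
          rw [weight]; ring
  -- Only the norms of the gradient embeddings are shown to converge: `ρ Gᵢ Φ` is not assumed
  -- Bochner integrable. The reverse triangle inequality makes this sufficient.
  have hsum : ∀ i, Tendsto (fun n => ‖gradEmbedding Φ μ G ρ (χ n) i
      + boundaryEmbedding Φ (fun x => q x / p x) ρ (χ n) i‖ ^ 2) atTop
      (𝓝 (∫ z : Rd d × Rd d, (ρ z.1 * G z.1 i) * k z.1 z.2 * (ρ z.2 * G z.2 i)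
        ∂(μ.prod μ))) := by
    intro i
    have h1 := (hgrad i).sqrt
    simp only [Real.sqrt_sq (norm_nonneg _)] at h1
    have h2 : Tendsto (fun n => ‖gradEmbedding Φ μ G ρ (χ n) i
        + boundaryEmbedding Φ (fun x => q x / p x) ρ (χ n) i‖
        - ‖gradEmbedding Φ μ G ρ (χ n) i‖) atTop (𝓝 0) := by
      refine squeeze_zero_norm (fun n => ?_) (hbdry i)
      refine (abs_norm_sub_norm_le _ _).trans_eq ?_
      rw [add_sub_cancel_left]
    have h3 := (h2.add h1).pow 2
    simp only [sub_add_cancel, zero_add] at h3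
    rwa [Real.sq_sqrt (ge_of_tendsto' (hgrad i) fun n => sq_nonneg _)] at h3
  refine tendsto_nhds_unique hlimS ?_
  simp only [fun n => integral_cutoff_gfKernel hq hG hρ hρ_pos (hχ n) (hχs n) (hχ1 n) hk_smooth hΦ
    hS]
  exact tendsto_finsetSum _ fun i _ => hsum i

/-- The gradient-free kernelized Stein discrepancy separates distinct densities. -/
theorem integral_gfKernel_pos [IsLocallyFiniteMeasure μ] (hk : IsPDKernel k)
    (hk_smooth : ContDiff ℝ 2 fun z : Rd d × Rd d => k z.1 z.2)
    (hk_strict : IsIntegrallyStrictlyPD k μ) (hp : IsProbDensity p) (hp_pos : ∀ x, 0 < p x)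
    (hq : IsProbDensity q) (hρ : ContDiff ℝ 1 ρ) (hρ_pos : ∀ x, 0 < ρ x)
    (hG : HasDistribGradient (fun x => q x / p x) μ G)
    (hG_L2 : MemLp (fun x => ρ x • G x) 2 μ)
    (hG_energy : Integrable (fun z : Rd d × Rd d =>
      k z.1 z.2 * ‖ρ z.1 • G z.1‖ * ‖ρ z.2 • G z.2‖) (μ.prod μ))
    (hS : Integrable (fun z : Rd d × Rd d => gfKernel k ρ p z.1 z.2)
      ((densityMeasure q).prod (densityMeasure q)))
    (hStein : Integrable (fun x => weight ρ p x * Real.sqrt (k x x)) (densityMeasure q))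
    (hqp : ¬ (q =ᵐ[volume] p)) :
    0 < ∫ z : Rd d × Rd d, gfKernel k ρ p z.1 z.2
      ∂((densityMeasure q).prod (densityMeasure q)) := by
  rw [integral_gfKernel_eq hk hk_smooth hq hp_pos hρ hρ_pos hG hG_energy hS hStein]
  have hpos : ∀ i, ¬ ((fun x => ρ x * G x i) =ᵐ[μ] 0) →
      0 < ∫ z : Rd d × Rd d, (ρ z.1 * G z.1 i) * k z.1 z.2 * (ρ z.2 * G z.2 i) ∂(μ.prod μ) := by
    intro i hi
    refine hk_strict _ ?_ hi (integrable_coord_energy hk_smooth.continuous hρ.continuous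
      hG.locallyIntegrable_grad hG_energy i)
    refine hG_L2.mono (hρ.continuous.aestronglyMeasurable.mul
      (locallyIntegrable_coord hG.locallyIntegrable_grad i).aestronglyMeasurable)
      (Eventually.of_forall fun x => ?_)
    simpa using PiLp.norm_apply_le (ρ x • G x) i
  have hnonneg : ∀ i, 0 ≤ ∫ z : Rd d × Rd d, (ρ z.1 * G z.1 i) * k z.1 z.2 * (ρ z.2 * G z.2 i)
      ∂(μ.prod μ) := by
    intro i
    by_cases hi : (fun x => ρ x * G x i) =ᵐ[μ] 0
    · refine le_of_eq (Eq.symm (integral_eq_zero_of_ae ?_))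
      filter_upwards [Measure.quasiMeasurePreserving_fst.ae hi] with z hz
      simp only [Pi.zero_apply] at hz ⊢
      rw [hz, zero_mul, zero_mul]
    · exact (hpos i hi).le
  -- Otherwise `G` vanishes almost everywhere for `μ` as `ρ > 0`, so `q / p` is constant,
  -- contradicting the alternative.
  have hex : ∃ i, ¬ ((fun x => ρ x * G x i) =ᵐ[μ] 0) := by
    by_contra! hall
    have hG0 : ∀ᵐ x ∂μ, G x = 0 := by
      filter_upwards [ae_all_iff.2 hall] with x hx
      ext i
      have := hx i
      simpa [(hρ_pos x).ne'] using this
    obtain ⟨c, hc⟩ := ae_eq_const_of_weakGradient_eq_zero hG.locallyIntegrable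
      fun φ hφ hφs v => by
        rw [hG.integral_eq φ hφ hφs v, neg_eq_zero]
        refine integral_eq_zero_of_ae ?_
        filter_upwards [hG0] with x hx
        simp [hx]
    exact hqp (ae_eq_of_div_ae_eq_const hp hp_pos hq hc)
  obtain ⟨i, hi⟩ := hex
  exact Finset.sum_pos' (fun i _ => hnonneg i) ⟨i, Finset.mem_univ i, hpos i hi⟩

end SteinEnergy

/-! ### Consistency of the bootstrap test. -/

theorem mainTheorem9 {d : ℕ} (k : Rd d → Rd d → ℝ) (p q ρ : Rd d → ℝ)
    (μ : Measure (Rd d)) [IsLocallyFiniteMeasure μ] (G : Rd d → Rd d)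
    -- the kernel
    (hk : IsPDKernel k)
    (hk_smooth : ContDiff ℝ 2 fun z : Rd d × Rd d => k z.1 z.2)
    (hk_strict : IsIntegrallyStrictlyPD k μ)
    -- the model density, the data density and the surrogate
    (hp : IsProbDensity p) (hp_pos : ∀ x, 0 < p x)
    (hq : IsProbDensity q)
    (hρ : ContDiff ℝ 1 ρ) (hρ_pos : ∀ x, 0 < ρ x)
    -- `ρ ∇(q/p) = q w (s_q - s_p)` is square integrable
    (hG : HasDistribGradient (fun x => q x / p x) μ G)
    (hG_L2 : MemLp (fun x => ρ x • G x) 2 μ)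
    -- finiteness of the discrepancy, in its two forms
    (hG_energy : Integrable (fun z : Rd d × Rd d =>
      k z.1 z.2 * ‖ρ z.1 • G z.1‖ * ‖ρ z.2 • G z.2‖) (μ.prod μ))
    (hS : Integrable (fun z : Rd d × Rd d => gfKernel k ρ p z.1 z.2)
      ((densityMeasure q).prod (densityMeasure q)))
    -- no boundary terms at infinity
    (hStein : Integrable (fun x => weight ρ p x * Real.sqrt (k x x)) (densityMeasure q))
    -- the alternative
    (hqp : ¬ (q =ᵐ[volume] p))
    -- level and number of bootstrap replicates
    (α : ℝ) (hα : α ∈ Set.Ioo (0 : ℝ) 1) (m : ℕ → ℕ) (hm : ∀ n, 1 ≤ m n) :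
    Tendsto (fun n => testLaw q n (m n)
        {ω | critValue (gfKernel k ρ p) α ω.1 ω.2 ≤ uStat (gfKernel k ρ p) ω.1}) atTop (𝓝 1) ∧
    Tendsto (fun n => testLaw q n (m n)
        {ω | critValue (gfKernel k ρ p) α ω.1 ω.2 < uStat (gfKernel k ρ p) ω.1}) atTop (𝓝 1) := by
  have hpos := integral_gfKernel_pos hk hk_smooth hk_strict hp hp_pos hq hρ hρ_pos hG hG_L2
    hG_energy hS hStein hqp
  have hlt := tendsto_testLaw_of_integral_pos hq (gfKernel k ρ p) hS hpos hα m hm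
  have htest : ∀ n, IsProbabilityMeasure (testLaw q n (m n)) := fun n => by
    have := isProbabilityMeasure_densityMeasure hq
    unfold testLaw; infer_instance
  refine ⟨tendsto_of_tendsto_of_tendsto_of_le_of_le hlt tendsto_const_nhds
    (fun n => measure_mono fun ω hω => ?_) fun n => prob_le_one, hlt⟩
  exact le_of_lt (Set.mem_ofPred_eq ▸ hω)
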